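/- Let $(K,v_0)$ be a valued field with value group $v_0K$ (written additively) and residue field $Kv_0$, and let $K(x)$ be the rational function field in one variable; equivalent valuations are identified. **Approximation types.** For $c\in K$ let $B_\gamma(c,K)=\{a\in K: v_0(a-c)\ge\gamma\}$ ($\gamma\in v_0K\cup\{\infty\}$) and $B^\circ_\gamma(c,K)=\{a\in K: v_0(a-c)>\gamma\}$ ($\gamma\in v_0K$). An approximation type $\mathbf A$ over $(K,v_0)$ is either empty or a nest of closed and open balls that contains, with each ball, all larger balls. Balls carry their radius and kind: $\mathbf A$ is given by its closed balls $\mathbf A_\gamma$ and its open balls $\mathbf A_\gamma^\circ$, which are set to be $\emptyset$ if $\mathbf A$ contains no ball of that kind and radius. A ball is larger than another if they have a common centre and it has smaller radius, or the same radius and is closed. Put $\operatorname{supp}\mathbf A=\{\gamma:\mathbf A_\gamma\neq\emptyset\}$; $\bigcap\mathbf A$ is the intersection of all balls in $\mathbf A$ ($=K$ if $\mathbf A=\emptyset$). $\mathbf A$ is *trivial* if $\infty\in\operatorname{supp}\mathbf A$, and *immediate* if it is nonempty and $\bigcap\mathbf A=\emptyset$. An immediate $\mathbf A$ is *transcendental*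 if for every $f\in K[X]$ there is $\delta\in\operatorname{supp}\mathbf A$ such that $v_0f(c)$ is constant for $c\in\mathbf A_\delta$, and *algebraic* otherwise; it is a *completion type* if $\operatorname{supp}\mathbf A=v_0K$. A non-trivial $\mathbf A$ with $\bigcap\mathbf A\ne\emptyset$ is *value-extending* if $\mathbf A_\gamma^\circ\neq\emptyset$ for all $\gamma\in\operatorname{supp}\mathbf A$, and *residue-extending* if for every $c\in K$ there is $\gamma\in\operatorname{supp}\mathbf A$ with $c\in\mathbf A_\gamma\setminus\mathbf A_\gamma^\circ$. $\mathbf A$ is *pure* if it is transcendental immediate, value-extending or residue-extending, and *almost pure* if it is pure or an algebraic completion type. **Extensions.** Let $v$ be an extension of $v_0$ to $K(x)$. It is *immediate* if $vK(x)=v_0K$ and $K(x)v=Kv_0$; *value-transcendental* if $vK(x)/v_0K$ has rational rank $1$ and $K(x)v|Kv_0$ is algebraic; *residue-transcendental* if $K(x)v|Kv_0$ has transcendence degree $1$ and $vK(x)/v_0K$ is torsion. An element $t\in K(x)^\times$ is value-transcendental if $vt$ is not torsion modulo $v_0K$, and residue-transcendental if $vt=0$ and its residue $tv$ is transcendental over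 $Kv_0$. The approximation type $\operatorname{appr}_v(x,K)$ consists of the nonempty sets among $\{c\in K:v(x-c)\ge\gamma\}$ ($\gamma\in v_0K\cup\{\infty\}$), as closed balls, and $\{c\in K:v(x-c)>\gamma\}$ ($\gamma\in v_0K$), as open balls. The extension $v$ is *pure* if $d(x-b)$ is value-transcendental or residue-transcendental for some $b,d\in K$, or $\operatorname{appr}_v(x,K)$ is transcendental immediate; it is *almost pure* if it is pure or $\operatorname{appr}_v(x,K)$ is an algebraic completion type. **Theorem.** Let $v$ be an almost pure extension of $v_0$ to $K(x)$. Then exactly one of the following holds: $v$ is immediate, $v$ is value-transcendental, $v$ is residue-transcendental. Moreover: 1. $v$ is immediate if and only if $\operatorname{appr}_v(x,K)$ is transcendental immediate. If $\operatorname{appr}_v(x,K)$ is algebraic immediate, then $v$ is value-transcendental. 2. $v$ is value-transcendental if and only if $x-b$ is value-transcendental for some $b\in K$ or $\operatorname{appr}_v(x,K)$ is an algebraic completion type; if $v$ is pure, then it is value-transcendental if and only if $x-b$ is value-transcendental for some $b\in K$. There is $b\in K$ such that $x-b$ is value-transcendental if and only if $\operatorname{appr}_v(x,K)$ is value-extending.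 If $v_0K$ is divisible and $v$ is value-transcendental, then $v$ is the only almost pure extension with its approximation type $\operatorname{appr}_v(x,K)$. 3. $v$ is residue-transcendental if and only if $d(x-b)$ is residue-transcendental for some $b,d\in K$, and this holds if and only if $\operatorname{appr}_v(x,K)$ is residue-extending. In this case, $v$ is the only almost pure extension with its approximation type $\operatorname{appr}_v(x,K)$. 4. If $v_0K$ is divisible, then $v\mapsto\operatorname{appr}_v(x,K)$ is a bijection from the set of almost pure extensions of $v_0$ to $K(x)$ onto the set of almost pure approximation types over $(K,v_0)$. -/

import Mathlib

noncomputable section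

/-!
Conventions.  Valuations are considered up to equivalence, so a valued field `(K, v₀)` is given by
its valuation ring `O : ValuationSubring K`; then `O.valuation : K → O.ValueGroup` is the (surjective)
valuation, written multiplicatively.  Thus `O.ValueGroup` is `v₀K ∪ {∞}` with the reversed order:
the additive `v₀ a ≥ γ` reads `O.valuation a ≤ γ`, the additive `0` is `1`, and the additive `∞`
is `0`.
-/

section Extensions

variable {K : Type*} [Field K]

/-- An extension `v` of the valuation of `O` from `K` to the rational function field `K(x)`
(up to equivalence of valuations, i.e. given by its valuation ring, lying over `O`). -/
@[ext]
structure ValExt (O : ValuationSubring K) where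
  /-- the valuation ring of `v` in `K(x)` -/
  ring : ValuationSubring (RatFunc K)
  comap_eq : ring.comap (algebraMap K (RatFunc K)) = O

namespace ValExt

variable {O : ValuationSubring K} (v : ValExt O)

/-- The value `v t` of an element `t` of `K(x)`. -/
abbrev val (t : RatFunc K) : v.ring.ValueGroup := v.ring.valuation t

theorem mem_iff (a : K) : algebraMap K (RatFunc K) a ∈ v.ring ↔ a ∈ O := by
  conv_rhs => rw [← v.comap_eq]
  rfl

theorem val_le_val_iff (a b : K) :
    v.val (algebraMap K (RatFunc K) a) ≤ v.val (algebraMap K (RatFunc K) b) ↔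
      O.valuation a ≤ O.valuation b := by
  by_cases hb : b = 0
  · subst hb
    simp
  · have h1 : O.valuation b ≠ 0 := (Valuation.ne_zero_iff _).2 hb
    have hb' : algebraMap K (RatFunc K) b ≠ 0 := by simpa using hb
    have h2 : v.val (algebraMap K (RatFunc K) b) ≠ 0 := (Valuation.ne_zero_iff _).2 hb'
    rw [← div_le_one₀ (zero_lt_iff.2 h1), ← div_le_one₀ (zero_lt_iff.2 h2), ← map_div₀, ← map_div₀,
      ← map_div₀, ValuationSubring.valuation_le_one_iff, ValuationSubring.valuation_le_one_iff,
      mem_iff]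

theorem val_eq_val_iff (a b : K) :
    v.val (algebraMap K (RatFunc K) a) = v.val (algebraMap K (RatFunc K) b) ↔
      O.valuation a = O.valuation b := by
  simp only [le_antisymm_iff, val_le_val_iff]

/-- The canonical embedding `v₀K ∪ {∞} → vK(x) ∪ {∞}`; it sends `v₀ a` to `v a`. -/
def valueMap : O.ValueGroup →*₀ v.ring.ValueGroup where
  toFun r := v.val (algebraMap K (RatFunc K) (Function.surjInv O.valuation_surjective r))
  map_zero' := by
    have h := Function.surjInv_eq O.valuation_surjective 0
    rw [Valuation.zero_iff] at h
    simp [h]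
  map_one' := by
    have h : v.val (algebraMap K (RatFunc K) 1) = 1 := by simp
    rw [← h, val_eq_val_iff, Function.surjInv_eq O.valuation_surjective, map_one]
  map_mul' r s := by
    rw [← map_mul, ← map_mul, val_eq_val_iff, map_mul]
    simp only [Function.surjInv_eq]

theorem valueMap_valuation (a : K) :
    v.valueMap (O.valuation a) = v.val (algebraMap K (RatFunc K) a) := by
  change v.val _ = v.val _
  rw [val_eq_val_iff, Function.surjInv_eq O.valuation_surjective]

theorem valueMap_le_iff (r s : O.ValueGroup) : v.valueMap r ≤ v.valueMap s ↔ r ≤ s := by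
  obtain ⟨a, rfl⟩ := O.valuation_surjective r
  obtain ⟨b, rfl⟩ := O.valuation_surjective s
  rw [valueMap_valuation, valueMap_valuation, val_le_val_iff]

theorem valueMap_lt_iff (r s : O.ValueGroup) : v.valueMap r < v.valueMap s ↔ r < s := by
  rw [← not_le, ← not_le, valueMap_le_iff]

/-- The inclusion of the valuation ring of `K` into the valuation ring of `K(x)`. -/
def ringMap : O →+* v.ring :=
  (algebraMap K (RatFunc K)).restrict O v.ring fun a ha => (v.mem_iff a).2 ha

instance : IsLocalHom v.ringMap where
  map_nonunit a ha := by
    rw [ValuationSubring.valuation_eq_one_iff] at ha ⊢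
    have h : v.val (algebraMap K (RatFunc K) a) = v.val (algebraMap K (RatFunc K) 1) := by
      exact Eq.trans ha (by simp)
    rw [val_eq_val_iff] at h
    simpa using h

/-- The residue field `K(x)v` as an extension of the residue field `Kv₀`. -/
instance : Algebra (IsLocalRing.ResidueField O) (IsLocalRing.ResidueField v.ring) :=
  (IsLocalRing.ResidueField.map v.ringMap).toAlgebra

/-- The quotient group `vK(x)/v₀K`. -/
abbrev ValueQuotient : Type _ :=
  (v.ring.ValueGroup)ˣ ⧸ (Units.map (v.valueMap : O.ValueGroup →* v.ring.ValueGroup)).range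

/-- The rational rank `rr vK(x)/v₀K = dim_ℚ (ℚ ⊗ vK(x)/v₀K)`. -/
def rationalRank : Cardinal :=
  Module.rank ℚ (TensorProduct ℤ ℚ (Additive v.ValueQuotient))

/-- `(K(x)|K,v)` is immediate: the embeddings of value groups and of residue fields are onto. -/
def IsImmediate : Prop :=
  Function.Surjective v.valueMap ∧
    Function.Surjective
      (algebraMap (IsLocalRing.ResidueField O) (IsLocalRing.ResidueField v.ring))

/-- `(K(x)|K,v)` is value-transcendental: `vK(x)/v₀K` has rational rank `1` and `K(x)v|Kv₀` is
algebraic. -/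
def IsValueTranscendental : Prop :=
  v.rationalRank = 1 ∧
    Algebra.IsAlgebraic (IsLocalRing.ResidueField O) (IsLocalRing.ResidueField v.ring)

/-- `(K(x)|K,v)` is residue-transcendental: `K(x)v|Kv₀` has transcendence degree `1` and
`vK(x)/v₀K` is a torsion group. -/
def IsResidueTranscendental : Prop :=
  Algebra.trdeg (IsLocalRing.ResidueField O) (IsLocalRing.ResidueField v.ring) = 1 ∧
    IsMulTorsion v.ValueQuotient

/-- `t` is a value-transcendental element: `v t` is not a torsion element modulo `v₀K`
(in particular `t ≠ 0`). -/
def IsValueTranscendentalElt (t : RatFunc K) : Prop :=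
  t ≠ 0 ∧ ∀ n : ℕ, n ≠ 0 → v.val t ^ n ∉ Set.range v.valueMap

/-- `t` is a residue-transcendental element: `v t = 0` (additively) and the residue of `t` is
transcendental over `Kv₀`. -/
def IsResidueTranscendentalElt (t : RatFunc K) : Prop :=
  v.val t = 1 ∧ ∃ ht : t ∈ v.ring,
    Transcendental (IsLocalRing.ResidueField O) (IsLocalRing.residue v.ring ⟨t, ht⟩)

/-- `t` is a valuation-transcendental element. -/
def IsValuationTranscendentalElt (t : RatFunc K) : Prop :=
  v.IsValueTranscendentalElt t ∨ v.IsResidueTranscendentalElt t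

end ValExt

end Extensions

section ApproximationTypes

variable {K : Type*} [Field K]

/-- The closed ball of radius `r` and centre `c` (radius `r = 0`, i.e. additively `∞`, allowed). -/
def closedValBall (O : ValuationSubring K) (r : O.ValueGroup) (c : K) : Set K :=
  {a | O.valuation (a - c) ≤ r}

/-- The open ball of radius `r` and centre `c`. It is empty for `r = 0`, so that an open ball which
contains a point has a radius in the value group. -/
def openValBall (O : ValuationSubring K) (r : O.ValueGroup) (c : K) : Set K :=
  {a | O.valuation (a - c) < r}

/-- An approximation type over `(K, v₀)`: a full nest of closed and open balls, or empty.
It is given by its closed balls `closed r` and its open balls `opn r` of each radius, where the empty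
set stands for "there is no closed (open) ball of that radius in the nest".  A ball of the
nest has any of its points as a centre.  Fullness: with a ball, the nest contains all larger
balls, i.e. those with the same centre which have a larger radius, or are closed of the same radius;
in particular, the balls of the nest are linearly ordered by inclusion. -/
@[ext]
structure ApproxType (O : ValuationSubring K) where
  /-- the closed ball of radius `r` in the nest, or `∅` -/
  closed : O.ValueGroup → Set K
  /-- the open ball of radius `r` in the nest, or `∅` -/
  opn : O.ValueGroup → Set K
  closed_of_closed : ∀ r s c, c ∈ closed r → r ≤ s → closed s = closedValBall O s c
  opn_of_closed : ∀ r s c, c ∈ closed r → r < s → opn s = openValBall O s c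
  closed_of_opn : ∀ r s c, c ∈ opn r → r ≤ s → closed s = closedValBall O s c
  opn_of_opn : ∀ r s c, c ∈ opn r → r ≤ s → opn s = openValBall O s c

namespace ApproxType

variable {O : ValuationSubring K} (A : ApproxType O)

/-- The support of `A`: the radii of the closed balls in `A`. -/
def supp : Set O.ValueGroup := {r | (A.closed r).Nonempty}

/-- The intersection of all balls in `A` (equal to `K` if `A` is empty). -/
def inter : Set K :=
  {c | (∀ r, (A.closed r).Nonempty → c ∈ A.closed r) ∧ ∀ r, (A.opn r).Nonempty → c ∈ A.opn r}

/-- `A` is trivial: it contains a closed ball of radius `∞`, i.e. a point. -/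
def IsTrivial : Prop := (A.closed 0).Nonempty

/-- `A` is immediate: it is nonempty, and its balls have empty intersection. -/
def IsImmediate : Prop := A.supp.Nonempty ∧ A.inter = ∅

/-- `A` fixes the value of `f`: `v₀ f(c)` is constant for `c` in some closed ball of `A`. -/
def FixesValue (f : Polynomial K) : Prop :=
  ∃ r ∈ A.supp, ∃ β : O.ValueGroup, ∀ c ∈ A.closed r, O.valuation (f.eval c) = β

/-- `A` is a transcendental immediate approximation type. -/
def IsTranscendentalImmediate : Prop := A.IsImmediate ∧ ∀ f : Polynomial K, A.FixesValue f

/-- `A` is an algebraic immediate approximation type. -/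
def IsAlgebraicImmediate : Prop := A.IsImmediate ∧ ∃ f : Polynomial K, ¬ A.FixesValue f

/-- `A` is a completion type: it is immediate with support `v₀K`. -/
def IsCompletionType : Prop := A.IsImmediate ∧ A.supp = {r | r ≠ 0}

/-- `A` is an algebraic completion type. -/
def IsAlgebraicCompletionType : Prop := A.IsCompletionType ∧ A.IsAlgebraicImmediate

/-- `A` is value-extending. -/
def IsValueExtending : Prop :=
  ¬ A.IsTrivial ∧ (∀ r ∈ A.supp, (A.opn r).Nonempty) ∧ A.inter.Nonempty

/-- `A` is residue-extending. -/
def IsResidueExtending : Prop :=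
  ¬ A.IsTrivial ∧ (∀ c : K, ∃ r ∈ A.supp, c ∈ A.closed r \ A.opn r) ∧ A.inter.Nonempty

/-- `A` is a pure approximation type. -/
def IsPure : Prop := A.IsTranscendentalImmediate ∨ A.IsValueExtending ∨ A.IsResidueExtending

/-- `A` is an almost pure approximation type. -/
def IsAlmostPure : Prop := A.IsPure ∨ A.IsAlgebraicCompletionType

end ApproxType

end ApproximationTypes

namespace ValExt

variable {K : Type*} [Field K] {O : ValuationSubring K} (v : ValExt O)

theorem val_X_sub_le (r : O.ValueGroup) (c a : K)
    (hc : v.val (RatFunc.X - RatFunc.C c) ≤ v.valueMap r) :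
    v.val (RatFunc.X - RatFunc.C a) ≤ v.valueMap r ↔ O.valuation (a - c) ≤ r := by
  rw [← valueMap_le_iff v, valueMap_valuation]
  have e : algebraMap K (RatFunc K) (a - c) =
      (RatFunc.X - RatFunc.C c) - (RatFunc.X - RatFunc.C a) := by
    rw [map_sub, RatFunc.algebraMap_eq_C]; ring
  rw [e]
  constructor
  · intro h
    exact (Valuation.map_sub _ _ _).trans (max_le hc h)
  · intro h
    have := (Valuation.map_sub v.ring.valuation (RatFunc.X - RatFunc.C c) _).trans (max_le hc h)
    simpa using this

theorem val_X_sub_lt (r : O.ValueGroup) (c a : K)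
    (hc : v.val (RatFunc.X - RatFunc.C c) < v.valueMap r) :
    v.val (RatFunc.X - RatFunc.C a) < v.valueMap r ↔ O.valuation (a - c) < r := by
  rw [← valueMap_lt_iff v, valueMap_valuation]
  have e : algebraMap K (RatFunc K) (a - c) =
      (RatFunc.X - RatFunc.C c) - (RatFunc.X - RatFunc.C a) := by
    rw [map_sub, RatFunc.algebraMap_eq_C]; ring
  rw [e]
  constructor
  · intro h
    exact (Valuation.map_sub _ _ _).trans_lt (max_lt hc h)
  · intro h
    have := (Valuation.map_sub v.ring.valuation (RatFunc.X - RatFunc.C c) _).trans_lt (max_lt hc h)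
    simpa using this

/-- The approximation type `appr_v(x,K)` of `x` over `(K,v₀)`: its closed and open balls are the
nonempty ones among `{c ∈ K | v (x - c) ≥ γ}` and `{c ∈ K | v (x - c) > γ}` (additively). -/
def appr : ApproxType O where
  closed r := {c | v.val (RatFunc.X - RatFunc.C c) ≤ v.valueMap r}
  opn r := {c | v.val (RatFunc.X - RatFunc.C c) < v.valueMap r}
  closed_of_closed r s c hc hrs := by
    ext a
    exact v.val_X_sub_le s c a (le_trans hc ((v.valueMap_le_iff r s).2 hrs))
  opn_of_closed r s c hc hrs := by
    ext a
    exact v.val_X_sub_lt s c a (lt_of_le_of_lt hc ((v.valueMap_lt_iff r s).2 hrs))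
  closed_of_opn r s c hc hrs := by
    ext a
    exact v.val_X_sub_le s c a (le_trans (le_of_lt hc) ((v.valueMap_le_iff r s).2 hrs))
  opn_of_opn r s c hc hrs := by
    ext a
    exact v.val_X_sub_lt s c a (lt_of_lt_of_le hc ((v.valueMap_le_iff r s).2 hrs))

/-- `(K(x)|K,v)` is pure (in `x`). -/
def IsPure : Prop :=
  (∃ b d : K, v.IsValuationTranscendentalElt (RatFunc.C d * (RatFunc.X - RatFunc.C b))) ∨
    v.appr.IsTranscendentalImmediate

/-- `(K(x)|K,v)` is almost pure (in `x`). -/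
def IsAlmostPure : Prop := v.IsPure ∨ v.appr.IsAlgebraicCompletionType

end ValExt

/-- The value group of `O` is divisible (written multiplicatively: every element has `n`-th roots
for all `n ≥ 1`). -/
def ValuationSubring.IsDivisible {K : Type*} [Field K] (O : ValuationSubring K) : Prop :=
  ∀ n : ℕ, n ≠ 0 → Function.Surjective fun g : (O.ValueGroup)ˣ => g ^ n

end

/-! An almost pure extension falls under one of four cases: some x - b is value-transcendental, some
d(x - b) is residue-transcendental, `appr` is transcendental immediate, or `appr` is an algebraic
completion type. For each case both the kind of the extension and the kind of its approximation type
are computed. The three kinds of extension exclude each other, and so do the relevant kinds of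
approximation types, so all the equivalences follow by elimination. Values are multiplicative: small
values mean closeness.

In the first two cases v is the Gauss valuation in x - b: v(f) is the maximum of the values of the
Taylor terms of f at b (`IsGaussAt`). If x - b is value-transcendental, one Taylor term strictly
dominates, so every rational function is approximated by a monomial a(x - b)^n; the value group
grows by one free generator and the residue field not at all. If t = d(x - b) is
residue-transcendental, every polynomial is a constant times a primitive polynomial in t, so there
are no new values and the residue field is generated by the residue of t.

In the immediate cases f(x) is compared with f(c) for c running into the nest. For a transcendental
type, Kaplansky's argument with a dominant Taylor term shows that f(c) approximates f(x), so v is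
immediate. For a completion type, polynomials are Lipschitz and f(c) converges to f(x); if the type
is algebraic, some p(x) is nonzero but smaller than all of v₀K. With p of least degree, Euclidean
division by p approximates every polynomial by some a p^k, so p is a value-transcendental element
which generates the new values.

Uniqueness: a Gauss valuation is determined by comparing monomials, and the approximation type
decides these comparisons (with roots in v₀K in the value-extending case, whence divisibility). In
the immediate cases the valuation ring consists of the functions that are integral at the points
near the nest. Existence: a Gauss valuation with x - c sent to an element of v₀K, or to an element
filling a cut of the divisible group v₀K; or the ring of functions eventually integral along the
nest (`limitExt`). -/

noncomputable section

open Polynomial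

/-! ### Gauss valuations -/

namespace Valuation

section Gauss

variable {K Γ : Type*} [Field K] [LinearOrderedCommGroupWithZero Γ] (w : Valuation K Γ) (φ : Γ)

/-- The Gauss value `max_i w(a_i) φ ^ i` of a polynomial `∑ a_i X ^ i`. -/
def gaussValue (f : K[X]) : Γ := f.support.sup fun i => w (f.coeff i) * φ ^ i

theorem gaussValue_zero : w.gaussValue φ 0 = 0 := by
  simp [gaussValue, bot_eq_zero]

theorem coeff_le_gaussValue (f : K[X]) (i : ℕ) : w (f.coeff i) * φ ^ i ≤ w.gaussValue φ f := by
  by_cases hi : i ∈ f.support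
  · exact Finset.le_sup (f := fun i => w (f.coeff i) * φ ^ i) hi
  · rw [notMem_support_iff.1 hi]
    simp

theorem gaussValue_le_iff {f : K[X]} {r : Γ} :
    w.gaussValue φ f ≤ r ↔ ∀ i, w (f.coeff i) * φ ^ i ≤ r :=
  ⟨fun h i => (w.coeff_le_gaussValue φ f i).trans h, fun h => Finset.sup_le fun i _ => h i⟩

theorem exists_coeff_eq_gaussValue (f : K[X]) :
    ∃ i, w (f.coeff i) * φ ^ i = w.gaussValue φ f := by
  by_cases hf : f.support.Nonempty
  · obtain ⟨i, -, hi⟩ := Finset.exists_mem_eq_sup _ hf fun i => w (f.coeff i) * φ ^ i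
    exact ⟨i, hi.symm⟩
  · rw [Finset.not_nonempty_iff_eq_empty, support_eq_empty] at hf
    exact ⟨0, by simp [hf, gaussValue_zero]⟩

theorem gaussValue_add_le (f g : K[X]) :
    w.gaussValue φ (f + g) ≤ max (w.gaussValue φ f) (w.gaussValue φ g) := by
  rw [gaussValue_le_iff]
  intro i
  rw [coeff_add]
  calc w (f.coeff i + g.coeff i) * φ ^ i ≤ max (w (f.coeff i)) (w (g.coeff i)) * φ ^ i := by
        gcongr; exact w.map_add _ _
    _ = max (w (f.coeff i) * φ ^ i) (w (g.coeff i) * φ ^ i) := max_mul_mul_right _ _ _ |>.symm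
    _ ≤ _ := max_le_max (w.coeff_le_gaussValue φ f i) (w.coeff_le_gaussValue φ g i)

variable {φ} (hφ : φ ≠ 0)

include hφ in
theorem gaussValue_eq_zero_iff {f : K[X]} : w.gaussValue φ f = 0 ↔ f = 0 := by
  constructor
  · intro h
    ext i
    have h1 := (w.gaussValue_le_iff φ (f := f) (r := 0)).1 h.le i
    simpa [hφ] using h1
  · rintro rfl
    exact w.gaussValue_zero φ

-- Gauss's lemma: if i₀ and j₀ are the least indices at which f and g attain their Gauss values, the
-- summand at (i₀, j₀) strictly dominates the coefficient of degree i₀ + j₀ of the product.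
include hφ in
theorem gaussValue_mul (f g : K[X]) :
    w.gaussValue φ (f * g) = w.gaussValue φ f * w.gaussValue φ g := by
  classical
  apply le_antisymm
  · rw [gaussValue_le_iff]
    intro n
    rw [coeff_mul]
    rw [← le_mul_inv_iff₀ (pow_pos (zero_lt_iff.2 hφ) n)]
    apply w.map_sum_le
    rintro ⟨i, j⟩ hij
    rw [Finset.HasAntidiagonal.mem_antidiagonal] at hij
    rw [le_mul_inv_iff₀ (pow_pos (zero_lt_iff.2 hφ) n), map_mul, ← hij, pow_add, mul_mul_mul_comm]
    exact mul_le_mul' (w.coeff_le_gaussValue φ f i) (w.coeff_le_gaussValue φ g j)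
  · by_cases hf : f = 0
    · simp [hf, gaussValue_zero]
    by_cases hg : g = 0
    · simp [hg, gaussValue_zero]
    have hf0 := mt (w.gaussValue_eq_zero_iff hφ).1 hf
    have hg0 := mt (w.gaussValue_eq_zero_iff hφ).1 hg
    have ef := w.exists_coeff_eq_gaussValue φ f
    have eg := w.exists_coeff_eq_gaussValue φ g
    have hi := Nat.find_spec ef
    have hj := Nat.find_spec eg
    set i₀ := Nat.find ef
    set j₀ := Nat.find eg
    have hi' : ∀ i < i₀, w (f.coeff i) * φ ^ i < w.gaussValue φ f := fun i h =>
      lt_of_le_of_ne (w.coeff_le_gaussValue φ f i) (Nat.find_min ef h)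
    have hj' : ∀ j < j₀, w (g.coeff j) * φ ^ j < w.gaussValue φ g := fun j h =>
      lt_of_le_of_ne (w.coeff_le_gaussValue φ g j) (Nat.find_min eg h)
    refine le_trans (le_of_eq ?_) (w.coeff_le_gaussValue φ (f * g) (i₀ + j₀))
    rw [coeff_mul, w.map_sum_eq_of_lt (j := (i₀, j₀)), map_mul, ← hi, ← hj, pow_add,
      mul_mul_mul_comm]
    · simp
    · rintro ⟨i, j⟩ h
      simp only [Finset.mem_sdiff, Finset.HasAntidiagonal.mem_antidiagonal, Finset.mem_singleton,
        Prod.mk.injEq] at h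
      obtain ⟨h1, h2⟩ := h
      rw [← mul_lt_mul_iff_left₀ (pow_pos (zero_lt_iff.2 hφ) (i₀ + j₀))]
      nth_rw 1 [← h1]
      rw [pow_add, pow_add, map_mul, map_mul]
      dsimp only
      rw [mul_mul_mul_comm, mul_mul_mul_comm (w (f.coeff i₀)), hi, hj]
      rcases lt_or_ge i i₀ with h3 | h3
      · calc _ ≤ (w (f.coeff i) * φ ^ i) * w.gaussValue φ g :=
              mul_le_mul_right (w.coeff_le_gaussValue φ g j) _
          _ < _ := mul_lt_mul_of_pos_right (hi' i h3) (zero_lt_iff.2 hg0)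
      · have h4 : j < j₀ := by omega
        calc _ ≤ w.gaussValue φ f * (w (g.coeff j) * φ ^ j) :=
              mul_le_mul_left (w.coeff_le_gaussValue φ f i) _
          _ < _ := mul_lt_mul_of_pos_left (hj' j h4) (zero_lt_iff.2 hf0)

/-- The Gauss valuation on `K[X]` with `X ↦ φ`. -/
def gauss : Valuation K[X] Γ where
  toFun := w.gaussValue φ
  map_zero' := w.gaussValue_zero φ
  map_one' := by
    apply le_antisymm
    · rw [gaussValue_le_iff]
      intro i
      rw [coeff_one]
      split_ifs with h <;> simp [h]
    · simpa using w.coeff_le_gaussValue φ 1 0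
  map_mul' := w.gaussValue_mul hφ
  map_add_le_max' := w.gaussValue_add_le φ

theorem gauss_X_add_C (a : K) : w.gauss hφ (X + C a) = max φ (w a) := by
  apply le_antisymm
  · refine (Valuation.map_add _ _ _).trans (max_le_max ?_ ?_) <;>
    · change w.gaussValue φ _ ≤ _
      rw [gaussValue_le_iff]
      rintro (_ | _ | i) <;> simp [coeff_X, coeff_C]
  · have h0 := w.coeff_le_gaussValue φ (X + C a) 0
    have h1 := w.coeff_le_gaussValue φ (X + C a) 1
    simp [coeff_C] at h0 h1
    exact max_le h1 h0

theorem gauss_C (a : K) : w.gauss hφ (C a) = w a := by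
  apply le_antisymm
  · change w.gaussValue φ _ ≤ _
    rw [gaussValue_le_iff]
    rintro (_ | i) <;> simp [coeff_C]
  · have h := w.coeff_le_gaussValue φ (C a) 0
    simp only [coeff_C_zero, pow_zero, mul_one] at h
    exact h

/-- The Gauss valuation on `K(X)` with `X - c ↦ φ`. -/
def gaussRatFunc (c : K) : Valuation (RatFunc K) Γ :=
  ((w.gauss hφ).comap (taylorEquiv c : K[X] ≃+* K[X]).toRingHom).extendToLocalization
    (S := nonZeroDivisors K[X]) (by
      intro f hf
      rw [Ideal.mem_primeCompl_iff, Valuation.mem_supp_iff, Valuation.comap_apply]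
      change ¬ w.gaussValue φ (taylor c f) = 0
      rw [gaussValue_eq_zero_iff w hφ]
      exact fun h => nonZeroDivisors.ne_zero hf (taylor_injective c (by simpa using h)))
    (RatFunc K)

theorem gaussRatFunc_algebraMap (c : K) (f : K[X]) :
    w.gaussRatFunc hφ c (algebraMap K[X] (RatFunc K) f) = w.gauss hφ (taylor c f) := by
  rw [gaussRatFunc, Valuation.extendToLocalization_apply_map_apply]
  rfl

theorem gaussRatFunc_X_sub_C (c a : K) :
    w.gaussRatFunc hφ c (RatFunc.X - RatFunc.C a) = max φ (w (c - a)) := by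
  rw [← RatFunc.algebraMap_X, ← RatFunc.algebraMap_C, ← _root_.map_sub, gaussRatFunc_algebraMap]
  rw [← gauss_X_add_C w hφ]
  congr 1
  simp
  ring

theorem gaussRatFunc_C (c a : K) : w.gaussRatFunc hφ c (RatFunc.C a) = w a := by
  rw [← RatFunc.algebraMap_C, gaussRatFunc_algebraMap, taylor_C, gauss_C]

end Gauss

end Valuation

/-! ### Filling a cut of a divisible ordered group -/

section Cut

/-- The group `G × ℤ`, to be ordered by means of a cut of `G`. -/
def CutGroup (G : Type*) : Type _ := G × Multiplicative ℤ

instance (G : Type*) [CommGroup G] : CommGroup (CutGroup G) :=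
  inferInstanceAs (CommGroup (G × Multiplicative ℤ))

variable {G : Type*} [CommGroup G] [LinearOrder G] [IsOrderedMonoid G]

theorem zpow_le_zpow_left_of_nonpos {a b : G} {n : ℤ} (hn : n ≤ 0) (h : a ≤ b) : b ^ n ≤ a ^ n := by
  rw [← inv_le_inv_iff, ← zpow_neg, ← zpow_neg]
  exact zpow_le_zpow_left (by omega) h

/-- The cone of the order on `G × ℤ` in which the generator of `ℤ` lies right below the final
segment `S` of the divisible group `G`. -/
def cutCone (S : Set G) (hS : ∀ r ∈ S, ∀ s, r ≤ s → s ∈ S) : GroupCone (CutGroup G) where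
  -- The pair (g, n) stands for g t^n. It is declared ≥ 1 if g h^n ≥ 1 for some h such that h^n
  -- underestimates t^n: h below the cut for n > 0, above it for n < 0.
  carrier := {p | ∃ h : G, 1 ≤ p.1 * h ^ (p.2.toAdd) ∧ (0 < p.2.toAdd → h ∉ S) ∧
    (p.2.toAdd < 0 → h ∈ S)}
  one_mem' := ⟨1, by
    change 1 ≤ (1 : G) * 1 ^ (0 : ℤ) ∧ (0 < (0 : ℤ) → _) ∧ ((0 : ℤ) < 0 → _)
    simp⟩
  mul_mem' := by
    rintro ⟨g, n⟩ ⟨g', n'⟩ ⟨h, h1, h2, h3⟩ ⟨h', h1', h2', h3'⟩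
    change ∃ k : G, 1 ≤ (g * g') * k ^ (n.toAdd + n'.toAdd) ∧ (0 < n.toAdd + n'.toAdd → k ∉ S) ∧
      (n.toAdd + n'.toAdd < 0 → k ∈ S)
    dsimp only at h1 h2 h3 h1' h2' h3'
    generalize n.toAdd = a at *
    generalize n'.toAdd = b at *
    -- A common witness k works for the product once k^a and k^b dominate h^a and h'^b. According to
    -- the signs, k is h, h', their minimum or maximum, or 1.
    have key : ∀ k : G, h ^ a ≤ k ^ a → h' ^ b ≤ k ^ b → 1 ≤ (g * g') * k ^ (a + b) := by
      intro k hk hk'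
      calc 1 ≤ (g * h ^ a) * (g' * h' ^ b) := one_le_mul h1 h1'
        _ ≤ (g * k ^ a) * (g' * k ^ b) :=
          mul_le_mul' (mul_le_mul_right hk _) (mul_le_mul_right hk' _)
        _ = _ := by rw [zpow_add, mul_mul_mul_comm]
    have lt_of : ∀ x y : G, x ∉ S → y ∈ S → x ≤ y := fun x y hx hy =>
      le_of_not_ge fun h => hx (hS y hy x h)
    rcases lt_trichotomy a 0 with ha | ha | ha <;> rcases lt_trichotomy b 0 with hb | hb | hb
    · have : min h h' ∈ S := by rcases min_choice h h' with e | e <;> rw [e] <;> tauto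
      exact ⟨min h h', key _ (zpow_le_zpow_left_of_nonpos ha.le (min_le_left _ _))
        (zpow_le_zpow_left_of_nonpos hb.le (min_le_right _ _)), fun _ => by omega, fun _ => this⟩
    · exact ⟨h, key _ le_rfl (by simp [hb]), fun _ => by omega, fun _ => h3 ha⟩
    · have hh := lt_of _ _ (h2' hb) (h3 ha)
      rcases lt_or_ge 0 (a + b) with hc | hc
      · exact ⟨h', key _ (zpow_le_zpow_left_of_nonpos ha.le hh) le_rfl, fun _ => h2' hb,
          fun _ => by omega⟩
      · exact ⟨h, key _ le_rfl (zpow_le_zpow_left hb.le hh), fun _ => by omega, fun _ => h3 ha⟩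
    · exact ⟨h', key _ (by simp [ha]) le_rfl, fun _ => by omega, fun _ => h3' hb⟩
    · exact ⟨1, key _ (by simp [ha]) (by simp [hb]), fun _ => by omega, fun _ => by omega⟩
    · exact ⟨h', key _ (by simp [ha]) le_rfl, fun _ => h2' hb, fun _ => by omega⟩
    · have hh := lt_of _ _ (h2 ha) (h3' hb)
      rcases lt_or_ge 0 (a + b) with hc | hc
      · exact ⟨h, key _ le_rfl (zpow_le_zpow_left_of_nonpos hb.le hh), fun _ => h2 ha,
          fun _ => by omega⟩
      · exact ⟨h', key _ (zpow_le_zpow_left ha.le hh) le_rfl, fun _ => by omega, fun _ => h3' hb⟩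
    · exact ⟨h, key _ le_rfl (by simp [hb]), fun _ => h2 ha, fun _ => by omega⟩
    · have : max h h' ∉ S := by rcases max_choice h h' with e | e <;> rw [e] <;> tauto
      exact ⟨max h h', key _ (zpow_le_zpow_left ha.le (le_max_left _ _))
        (zpow_le_zpow_left hb.le (le_max_right _ _)), fun _ => this, fun _ => by omega⟩
  eq_one_of_mem_of_inv_mem' := by
    rintro ⟨g, n⟩ ⟨h, h1, h2, h3⟩ ⟨h', h1', h2', h3'⟩
    change 1 ≤ g⁻¹ * h' ^ (-n.toAdd) at h1'
    change 0 < -n.toAdd → _ at h2'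
    change -n.toAdd < 0 → _ at h3'
    change (g, n) = (1, 1)
    dsimp only at h1 h2 h3
    rw [zpow_neg, ← mul_inv, one_le_inv'] at h1'
    have hh : g * h' ^ n.toAdd ≤ g * h ^ n.toAdd := h1'.trans h1
    rw [mul_le_mul_iff_left] at hh
    -- For n ≠ 0 the witnesses h and h' lie on opposite sides of the cut, and the inequality of
    -- their powers puts them in the wrong order.
    rcases lt_trichotomy n.toAdd 0 with hn | hn | hn
    · refine absurd (hS h (h3 hn) h' ?_) (h2' (by omega))
      by_contra! hlt
      exact absurd hh (not_le.2 (by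
        rw [← inv_lt_inv_iff, ← zpow_neg, ← zpow_neg]
        exact zpow_left_strictMono G (by omega) hlt))
    · have : n = 1 := by exact hn
      subst this
      simp only [toAdd_one, zpow_zero, mul_one] at h1 h1'
      rw [le_antisymm h1' h1]
    · refine absurd (hS h' (h3' (by omega)) h ?_) (h2 (by omega))
      by_contra! hlt
      exact absurd hh (not_le.2 (zpow_left_strictMono G hn hlt))

theorem mem_cutCone {S : Set G} {hS : ∀ r ∈ S, ∀ s, r ≤ s → s ∈ S} {p : CutGroup G} :
    p ∈ cutCone S hS ↔ ∃ h : G, 1 ≤ p.1 * h ^ (p.2.toAdd) ∧ (0 < p.2.toAdd → h ∉ S) ∧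
    (p.2.toAdd < 0 → h ∈ S) := Iff.rfl

/-- Divisibility gives g = k^(-a), so g t^a = (t / k)^a, and its sign is decided by the side of the
cut on which k lies. -/
theorem hasMemOrInvMem_cutCone (S : Set G) (hS : ∀ r ∈ S, ∀ s, r ≤ s → s ∈ S)
    (hdiv : ∀ n : ℕ, n ≠ 0 → Function.Surjective fun g : G => g ^ n) :
    HasMemOrInvMem (cutCone S hS) where
  mem_or_inv_mem := by
    rintro ⟨g, n⟩
    change (∃ h : G, 1 ≤ g * h ^ n.toAdd ∧ (0 < n.toAdd → h ∉ S) ∧ (n.toAdd < 0 → h ∈ S)) ∨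
      ∃ h : G, 1 ≤ g⁻¹ * h ^ (-n.toAdd) ∧ (0 < -n.toAdd → h ∉ S) ∧ (-n.toAdd < 0 → h ∈ S)
    generalize n.toAdd = a
    by_cases ha : a = 0
    · subst ha
      simpa using le_total 1 g
    obtain ⟨k, hk⟩ : ∃ k : G, g = k ^ (-a) := by
      obtain ⟨k, hk⟩ := hdiv a.natAbs (by omega) g
      dsimp only at hk
      rcases Int.natAbs_eq a with e | e
      · exact ⟨k⁻¹, by rw [e, inv_zpow, zpow_neg, inv_inv, zpow_natCast, hk]⟩
      · exact ⟨k, by rw [e, neg_neg, zpow_natCast, hk]⟩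
    subst hk
    by_cases hkS : k ∈ S <;> rcases lt_or_gt_of_ne ha with h | h
    · exact Or.inl ⟨k, by simp, fun _ => by omega, fun _ => hkS⟩
    · exact Or.inr ⟨k, by simp, fun _ => by omega, fun _ => hkS⟩
    · exact Or.inr ⟨k, by simp, fun _ => hkS, fun _ => by omega⟩
    · exact Or.inl ⟨k, by simp, fun _ => hkS, fun _ => by omega⟩

/-- Every cut of a divisible ordered group (with zero) is realized in an extension. -/
theorem exists_cut_realization.{u} {Γ : Type u} [LinearOrderedCommGroupWithZero Γ]
    (hdiv : ∀ n : ℕ, n ≠ 0 → Function.Surjective fun g : Γˣ => g ^ n)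
    (S : Set Γ) (h0 : 0 ∉ S) (hS : ∀ r ∈ S, ∀ s, r ≤ s → s ∈ S) :
    ∃ (Γ' : Type u) (_ : LinearOrderedCommGroupWithZero Γ') (e : Γ →*₀ Γ') (φ : Γ'),
      StrictMono e ∧ φ ≠ 0 ∧ (∀ r ∈ S, φ < e r) ∧ ∀ r ∉ S, e r < φ := by
  classical
  let T : Set Γˣ := {u | (u : Γ) ∈ S}
  have hT : ∀ r ∈ T, ∀ s, r ≤ s → s ∈ T := fun r hr s hrs => hS r hr s hrs
  let _ : HasMemOrInvMem (cutCone T hT) := hasMemOrInvMem_cutCone T hT hdiv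
  let _ : LinearOrder (CutGroup Γˣ) := LinearOrder.mkOfGroupCone (cutCone T hT)
  have : IsOrderedMonoid (CutGroup Γˣ) := IsOrderedMonoid.mkOfCone (cutCone T hT)
  have le_iff : ∀ p q : CutGroup Γˣ, p ≤ q ↔ q / p ∈ cutCone T hT := fun _ _ => Iff.rfl
  let f : Γˣ →* CutGroup Γˣ := MonoidHom.inl Γˣ (Multiplicative ℤ)
  let t : CutGroup Γˣ := (1, Multiplicative.ofAdd 1)
  have hf : StrictMono f := by
    intro r s hrs
    rw [← not_le, le_iff, mem_cutCone]
    rintro ⟨h, h1, -, -⟩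
    change 1 ≤ (r / s) * h ^ (0 : ℤ) at h1
    rw [zpow_zero, mul_one, one_le_div'] at h1
    exact absurd hrs (not_lt.2 h1)
  have htS : ∀ r ∈ T, t < f r := by
    intro r hr
    rw [← not_le, le_iff, mem_cutCone]
    rintro ⟨h, h1, h2, -⟩
    change 1 ≤ (1 / r) * h ^ (1 : ℤ) at h1
    rw [zpow_one, one_div, le_inv_mul_iff_mul_le, mul_one] at h1
    exact h2 (by change (0 : ℤ) < 1; norm_num) (hT r hr h h1)
  have htS' : ∀ r ∉ T, f r < t := by
    intro r hr
    rw [← not_le, le_iff, mem_cutCone]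
    rintro ⟨h, h1, -, h3⟩
    change 1 ≤ (r / 1) * h ^ (-1 : ℤ) at h1
    rw [zpow_neg_one, div_one, le_mul_inv_iff_mul_le, one_mul] at h1
    exact hr (hT h (h3 (by change (-1 : ℤ) < 0; norm_num)) r h1)
  let e : Γ →*₀ WithZero (CutGroup Γˣ) :=
    (WithZero.map' f).comp (WithZero.withZeroUnitsEquiv (G := Γ)).symm.toMonoidWithZeroHom
  have he : ∀ u : Γˣ, e u = (f u : WithZero (CutGroup Γˣ)) := by
    intro u
    change WithZero.map' f (WithZero.withZeroUnitsEquiv.symm (u : Γ)) = _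
    rw [WithZero.withZeroUnitsEquiv_symm_apply_coe, WithZero.map'_coe]
  refine ⟨WithZero (CutGroup Γˣ), inferInstance, e, (t : WithZero (CutGroup Γˣ)), ?_,
    WithZero.coe_ne_zero, ?_, ?_⟩
  · intro r s hrs
    have hs : s ≠ 0 := (lt_of_le_of_lt zero_le hrs).ne'
    lift s to Γˣ using hs.isUnit
    rw [he]
    rcases eq_or_ne r 0 with rfl | hr
    · rw [map_zero]
      exact zero_lt_iff.2 WithZero.coe_ne_zero
    · lift r to Γˣ using hr.isUnit
      rw [he, WithZero.coe_lt_coe]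
      exact hf hrs
  · intro r hr
    have hr0 : r ≠ 0 := fun h => h0 (h ▸ hr)
    lift r to Γˣ using hr0.isUnit
    rw [he, WithZero.coe_lt_coe]
    exact htS r hr
  · intro r hr
    rcases eq_or_ne r 0 with rfl | hr0
    · rw [map_zero]
      exact zero_lt_iff.2 WithZero.coe_ne_zero
    · lift r to Γˣ using hr0.isUnit
      rw [he, WithZero.coe_lt_coe]
      exact htS' r hr

end Cut

/-! ### Approximation by quotients and basic facts on extensions -/

namespace Valuation

variable {L Γ : Type*} [Field L] [LinearOrderedCommGroupWithZero Γ] (w : Valuation L Γ)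

/-- Approximation with an error of smaller value is compatible with quotients; this reduces rational
functions to their numerators and denominators. -/
theorem div_sub_div_lt {g h g' h' : L} (hg : w (g - g') < w g) (hh : w (h - h') < w h) :
    w (g / h - g' / h') < w (g / h) := by
  have eg : w g' = w g := w.map_eq_of_sub_lt (by rwa [map_sub_swap])
  have eh : w h' = w h := w.map_eq_of_sub_lt (by rwa [map_sub_swap])
  have hg0 : 0 < w g := lt_of_le_of_lt zero_le hg
  have hh0 : 0 < w h := lt_of_le_of_lt zero_le hh
  have h0 : h ≠ 0 := (w.ne_zero_iff).1 hh0.ne'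
  have h0' : h' ≠ 0 := (w.ne_zero_iff).1 (eh ▸ hh0.ne')
  have e : g / h - g' / h' = ((g - g') * h' - g' * (h - h')) / (h * h') := by
    field_simp
    ring
  have key : w ((g - g') * h' - g' * (h - h')) < w g * w h := by
    apply w.map_sub_lt
    · rw [_root_.map_mul, eh]
      exact mul_lt_mul_of_pos_right hg hh0
    · rw [_root_.map_mul, eg]
      exact mul_lt_mul_of_pos_left hh hg0
  rw [e, map_div₀, map_div₀, _root_.map_mul w h, eh, div_lt_iff₀ (mul_pos hh0 hh0)]
  calc _ < _ := key
    _ = _ := by field_simp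

end Valuation

namespace ValExt

variable {K : Type*} [Field K] {O : ValuationSubring K}

/-- The extension given by a valuation of `K(x)`. -/
def ofValuation {Γ : Type*} [LinearOrderedCommGroupWithZero Γ] (w : Valuation (RatFunc K) Γ)
    (h : ∀ a, w (RatFunc.C a) ≤ 1 ↔ a ∈ O) : ValExt O where
  ring := w.valuationSubring
  comap_eq := by
    ext a
    rw [← h]
    rfl

theorem ofValuation_val_le_iff {Γ : Type*} [LinearOrderedCommGroupWithZero Γ]
    (w : Valuation (RatFunc K) Γ) (h : ∀ a, w (RatFunc.C a) ≤ 1 ↔ a ∈ O) (f g : RatFunc K) :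
    (ofValuation w h).val f ≤ (ofValuation w h).val g ↔ w f ≤ w g :=
  (w.isEquiv_valuation_valuationSubring f g).symm

variable (v : ValExt O)

theorem val_zero : v.val 0 = 0 := Valuation.map_zero _

theorem val_one : v.val 1 = 1 := Valuation.map_one _

theorem val_mul (f g : RatFunc K) : v.val (f * g) = v.val f * v.val g := Valuation.map_mul _ _ _

theorem val_div (f g : RatFunc K) : v.val (f / g) = v.val f / v.val g := map_div₀ _ _ _

theorem val_pow (f : RatFunc K) (n : ℕ) : v.val (f ^ n) = v.val f ^ n := Valuation.map_pow _ _ _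

theorem val_zpow (f : RatFunc K) (n : ℤ) : v.val (f ^ n) = v.val f ^ n := map_zpow₀ _ _ _

variable {v} in
theorem val_eq_of_sub_lt {f g : RatFunc K} (h : v.val (f - g) < v.val f) : v.val g = v.val f :=
  Valuation.map_eq_of_sub_lt _ (by rwa [Valuation.map_sub_swap])

theorem val_C (a : K) : v.val (RatFunc.C a) = v.valueMap (O.valuation a) := by
  rw [valueMap_valuation, RatFunc.algebraMap_eq_C]

theorem valueMap_strictMono : StrictMono v.valueMap := fun r s => (v.valueMap_lt_iff r s).2

theorem valueMap_injective : Function.Injective v.valueMap := v.valueMap_strictMono.injective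

theorem X_sub_C_ne_zero (b : K) : (RatFunc.X - RatFunc.C b : RatFunc K) ≠ 0 := by
  rw [← RatFunc.algebraMap_X, ← RatFunc.algebraMap_C, ← map_sub]
  exact RatFunc.algebraMap_ne_zero (Polynomial.X_sub_C_ne_zero b)

theorem val_X_sub_C_ne_zero (b : K) : v.val (RatFunc.X - RatFunc.C b) ≠ 0 :=
  (Valuation.ne_zero_iff _).2 (X_sub_C_ne_zero b)

theorem val_X_sub_C_pos (b : K) : 0 < v.val (RatFunc.X - RatFunc.C b) :=
  zero_lt_iff.2 (v.val_X_sub_C_ne_zero b)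

theorem eq_of_val_le_iff {v w : ValExt O}
    (h : ∀ f g : K[X], v.val (algebraMap K[X] (RatFunc K) f) ≤ v.val (algebraMap _ _ g) ↔
      w.val (algebraMap K[X] (RatFunc K) f) ≤ w.val (algebraMap _ _ g)) : v = w := by
  ext f
  rw [← ValuationSubring.valuation_le_one_iff, ← ValuationSubring.valuation_le_one_iff,
    ← RatFunc.num_div_denom f, map_div₀, map_div₀]
  have hd : algebraMap K[X] (RatFunc K) f.denom ≠ 0 :=
    RatFunc.algebraMap_ne_zero f.denom_ne_zero
  rw [div_le_one₀ (zero_lt_iff.2 ((Valuation.ne_zero_iff _).2 hd)),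
    div_le_one₀ (zero_lt_iff.2 ((Valuation.ne_zero_iff _).2 hd))]
  exact h _ _

/-! ### Value groups and residue fields -/

theorem subsingleton_valueQuotient (h : Function.Surjective v.valueMap) :
    Subsingleton v.ValueQuotient := by
  rw [QuotientGroup.subsingleton_iff, MonoidHom.range_eq_top]
  intro u
  obtain ⟨r, hr⟩ := h u
  have hr0 : r ≠ 0 := by
    rintro rfl
    rw [map_zero] at hr
    exact u.ne_zero hr.symm
  exact ⟨Units.mk0 r hr0, Units.ext hr⟩

theorem residue_surjective (h : ∀ f, v.val f = 1 → ∃ a : K, v.val (f - RatFunc.C a) < 1) :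
    Function.Surjective
      (algebraMap (IsLocalRing.ResidueField O) (IsLocalRing.ResidueField v.ring)) := by
  intro y
  obtain ⟨⟨f, hf⟩, rfl⟩ := IsLocalRing.residue_surjective y
  rcases v.ring.valuation_lt_one_or_eq_one ⟨f, hf⟩ with h1 | h1
  · refine ⟨0, ?_⟩
    rw [map_zero, eq_comm, IsLocalRing.residue_eq_zero_iff]
    exact (v.ring.valuation_lt_one_iff ⟨f, hf⟩).2 h1
  · obtain ⟨a, ha⟩ := h f h1
    have hfa : f - RatFunc.C a ∈ v.ring := v.ring.mem_of_valuation_le_one _ ha.le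
    have ha' : RatFunc.C a ∈ v.ring := by
      have := v.ring.sub_mem hf hfa
      simpa using this
    have haO : a ∈ O := (v.mem_iff a).1 (by rwa [RatFunc.algebraMap_eq_C])
    refine ⟨IsLocalRing.residue O ⟨a, haO⟩, ?_⟩
    change IsLocalRing.residue v.ring (v.ringMap ⟨a, haO⟩) = _
    rw [eq_comm, ← sub_eq_zero, ← map_sub, IsLocalRing.residue_eq_zero_iff,
      ValuationSubring.valuation_lt_one_iff]
    exact ha

theorem isAlgebraic_of_residue_surjective (h : Function.Surjective
      (algebraMap (IsLocalRing.ResidueField O) (IsLocalRing.ResidueField v.ring))) :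
    Algebra.IsAlgebraic (IsLocalRing.ResidueField O) (IsLocalRing.ResidueField v.ring) where
  isAlgebraic y := by
    obtain ⟨x, rfl⟩ := h y
    exact isAlgebraic_algebraMap x

/-- An element and a constant that differ by less than their value have the same value and, if it is
1, the same residue; so nothing new appears. -/
theorem isImmediate_of_forall_exists
    (h : ∀ f, f ≠ 0 → ∃ a : K, v.val (f - RatFunc.C a) < v.val f) : v.IsImmediate := by
  constructor
  · intro r
    obtain ⟨f, rfl⟩ := v.ring.valuation_surjective r
    by_cases hf : f = 0
    · exact ⟨0, by simp [hf]⟩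
    obtain ⟨a, ha⟩ := h f hf
    exact ⟨O.valuation a, by
      rw [← val_C]
      exact Valuation.map_eq_of_sub_lt _ (by rwa [Valuation.map_sub_swap])⟩
  · apply v.residue_surjective
    intro f hf
    rw [← hf]
    exact h f (by rintro rfl; simp at hf)

theorem IsImmediate.not_isValueTranscendental {v : ValExt O} (h : v.IsImmediate) :
    ¬ v.IsValueTranscendental := by
  rintro ⟨h1, -⟩
  have := v.subsingleton_valueQuotient h.1
  have h2 : Subsingleton (TensorProduct ℤ ℚ (Additive v.ValueQuotient)) := by
    have : Subsingleton (Additive v.ValueQuotient) := this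
    infer_instance
  rw [rationalRank, rank_subsingleton'] at h1
  exact zero_ne_one h1

theorem IsImmediate.not_isResidueTranscendental {v : ValExt O} (h : v.IsImmediate) :
    ¬ v.IsResidueTranscendental := by
  rintro ⟨h1, -⟩
  have := v.isAlgebraic_of_residue_surjective h.2
  rw [trdeg_eq_zero] at h1
  exact zero_ne_one h1

theorem IsValueTranscendental.not_isResidueTranscendental {v : ValExt O}
    (h : v.IsValueTranscendental) : ¬ v.IsResidueTranscendental := by
  rintro ⟨h1, -⟩
  have := h.2
  rw [trdeg_eq_zero] at h1
  exact zero_ne_one h1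

variable {v} in
theorem IsValueTranscendentalElt.zpow_notMem {t : RatFunc K} (ht : v.IsValueTranscendentalElt t)
    {n : ℤ} (hn : n ≠ 0) : v.val t ^ n ∉ Set.range v.valueMap := by
  rintro ⟨r, hr⟩
  rcases Int.natAbs_eq n with e | e
  · refine ht.2 n.natAbs (by omega) ⟨r, ?_⟩
    rw [hr, ← zpow_natCast, ← e]
  · refine ht.2 n.natAbs (by omega) ⟨r⁻¹, ?_⟩
    rw [map_inv₀, hr, ← zpow_natCast, ← zpow_neg]
    congr 1
    omega

variable {v} in
theorem IsValueTranscendentalElt.exponent_eq {t : RatFunc K} (ht : v.IsValueTranscendentalElt t)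
    {a b : K} (ha : a ≠ 0) {m n : ℤ}
    (h : v.val (RatFunc.C a * t ^ m) = v.val (RatFunc.C b * t ^ n)) : m = n := by
  by_contra hmn
  refine ht.zpow_notMem (sub_ne_zero.2 hmn) ⟨O.valuation (b / a), ?_⟩
  have hv : v.val t ≠ 0 := (Valuation.ne_zero_iff _).2 ht.1
  have ha' : v.val (RatFunc.C a) ≠ 0 := (Valuation.ne_zero_iff _).2 (by simpa using ha)
  rw [← val_C, zpow_sub₀ hv, map_div₀, val_div]
  rw [val_mul, val_mul, val_zpow, val_zpow] at h
  field_simp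
  exact h.symm

/-- If all elements are approximated by monomials a t^n, then v₀K and v t generate the value group,
and the quotient is infinite cyclic. Elements of value 1 have exponent n = 0, hence residues from K.
-/
theorem isValueTranscendental_of_forall_exists {t : RatFunc K} (ht : v.IsValueTranscendentalElt t)
    (h : ∀ f, f ≠ 0 → ∃ a : K, ∃ n : ℤ, v.val (f - RatFunc.C a * t ^ n) < v.val f) :
    v.IsValueTranscendental := by
  have hval : ∀ f, f ≠ 0 → ∃ a : K, ∃ n : ℤ, a ≠ 0 ∧ v.val f = v.val (RatFunc.C a * t ^ n) ∧
      v.val (f - RatFunc.C a * t ^ n) < v.val f := by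
    intro f hf
    obtain ⟨a, n, han⟩ := h f hf
    have e : v.val (RatFunc.C a * t ^ n) = v.val f :=
      Valuation.map_eq_of_sub_lt _ (by rwa [Valuation.map_sub_swap])
    refine ⟨a, n, ?_, e.symm, han⟩
    rintro rfl
    rw [map_zero, zero_mul, val_zero, eq_comm, Valuation.zero_iff] at e
    exact hf e
  have ht0 : v.val t ≠ 0 := (Valuation.ne_zero_iff _).2 ht.1
  constructor
  · let x : Additive v.ValueQuotient := Additive.ofMul (QuotientGroup.mk (Units.mk0 _ ht0))
    have hx : ∀ n : ℤ, n • x = Additive.ofMul (QuotientGroup.mk (Units.mk0 _ ht0 ^ n)) :=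
      fun n => rfl
    have hbij : Function.Bijective (LinearMap.toSpanSingleton ℤ (Additive v.ValueQuotient) x) := by
      constructor
      · rw [injective_iff_map_eq_zero]
        intro n hn
        rw [LinearMap.toSpanSingleton_apply, hx] at hn
        have hn' : (QuotientGroup.mk (Units.mk0 _ ht0 ^ n) : v.ValueQuotient) = 1 := hn
        rw [QuotientGroup.eq_one_iff] at hn'
        obtain ⟨r, hr⟩ := hn'
        by_contra hn0
        refine ht.zpow_notMem hn0 ⟨r, ?_⟩
        have := congrArg Units.val hr
        simpa using this
      · intro q
        obtain ⟨u, hu⟩ := QuotientGroup.mk_surjective (Additive.toMul q)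
        obtain ⟨f, hf⟩ := v.ring.valuation_surjective u
        have hf0 : f ≠ 0 := by
          rintro rfl
          rw [map_zero] at hf
          exact u.ne_zero hf.symm
        obtain ⟨a, n, ha, e, -⟩ := hval f hf0
        refine ⟨n, ?_⟩
        rw [LinearMap.toSpanSingleton_apply, hx]
        apply Additive.toMul.injective
        rw [toMul_ofMul, ← hu, QuotientGroup.eq]
        have ha' : O.valuation a ≠ 0 := (Valuation.ne_zero_iff _).2 ha
        refine ⟨Units.mk0 _ ha', Units.ext ?_⟩
        have hv : v.val t ^ n ≠ 0 := zpow_ne_zero _ ht0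
        change v.valueMap (O.valuation a) = _
        rw [← val_C]
        simp only [Units.val_mul, Units.val_inv_eq_inv_val, Units.val_zpow_eq_zpow_val,
          Units.val_mk0]
        rw [← hf]
        change _ = _ * v.val f
        rw [e, val_mul, val_zpow]
        field_simp
    -- Tensoring ℤ ≃ vK(x)/v₀K with ℚ gives a one-dimensional space.
    have e1 := (LinearEquiv.ofBijective _ hbij).baseChange ℤ ℚ
    have e2 := (TensorProduct.AlgebraTensorModule.rid ℤ ℚ ℚ).symm.trans e1
    have := e2.lift_rank_eq
    rw [Module.rank_self, Cardinal.lift_one, eq_comm, Cardinal.lift_eq_one] at this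
    exact this
  · apply isAlgebraic_of_residue_surjective
    apply residue_surjective
    intro f hf
    have hf0 : f ≠ 0 := by
      rintro rfl
      simp at hf
    obtain ⟨a, n, ha, e, hlt⟩ := hval f hf0
    -- The value 1 is that of the monomial 1 · t^0, and the exponent is determined by the value.
    have hn : n = 0 := ht.exponent_eq ha (b := 1) (by rw [← e, hf]; simp)
    subst hn
    exact ⟨a, by simpa [hf] using hlt⟩

theorem exists_approx_of_polynomial {t : RatFunc K} (ht : t ≠ 0)
    (h : ∀ f : K[X], f ≠ 0 → ∃ a : K, ∃ n : ℤ,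
      v.val (algebraMap K[X] (RatFunc K) f - RatFunc.C a * t ^ n) <
        v.val (algebraMap K[X] (RatFunc K) f))
    (f : RatFunc K) (hf : f ≠ 0) :
    ∃ a : K, ∃ n : ℤ, v.val (f - RatFunc.C a * t ^ n) < v.val f := by
  obtain ⟨a, n, h1⟩ := h f.num (RatFunc.num_ne_zero hf)
  obtain ⟨b, m, h2⟩ := h f.denom f.denom_ne_zero
  refine ⟨a / b, n - m, ?_⟩
  have h3 := v.ring.valuation.div_sub_div_lt h1 h2
  rw [RatFunc.num_div_denom, mul_div_mul_comm, ← zpow_sub₀ ht, ← map_div₀] at h3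
  exact h3

/-! ### Expansions in powers of `x - b` -/

/-- The term of degree `i` of the expansion of `f` in powers of `x - b`. -/
def taylorTerm (b : K) (f : K[X]) (i : ℕ) : RatFunc K :=
  RatFunc.C ((taylor b f).coeff i) * (RatFunc.X - RatFunc.C b) ^ i

theorem sum_taylorTerm (b : K) (f : K[X]) :
    ∑ i ∈ (taylor b f).support, taylorTerm b f i = algebraMap K[X] (RatFunc K) f := by
  conv_rhs => rw [← sum_taylor_eq f b]
  rw [Polynomial.sum_def, map_sum]
  refine Finset.sum_congr rfl fun i _ => ?_
  rw [taylorTerm, map_mul, map_pow, map_sub, RatFunc.algebraMap_C, RatFunc.algebraMap_C,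
    RatFunc.algebraMap_X]

/-- `v` is the Gauss valuation with respect to `x - b`. -/
def IsGaussAt (b : K) : Prop :=
  ∀ (f : K[X]) (i : ℕ), v.val (taylorTerm b f i) ≤ v.val (algebraMap K[X] (RatFunc K) f)

variable {v}

theorem IsGaussAt.val_le_iff {b : K} (h : v.IsGaussAt b) (f : K[X]) (r : v.ring.ValueGroup) :
    v.val (algebraMap K[X] (RatFunc K) f) ≤ r ↔ ∀ i, v.val (taylorTerm b f i) ≤ r := by
  refine ⟨fun hr i => (h f i).trans hr, fun hr => ?_⟩
  rw [← sum_taylorTerm b f]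
  exact Valuation.map_sum_le _ fun i _ => hr i

theorem IsGaussAt.exists_val_eq {b : K} (h : v.IsGaussAt b) (f : K[X]) :
    ∃ i, v.val (algebraMap K[X] (RatFunc K) f) = v.val (taylorTerm b f i) := by
  by_cases hf : f = 0
  · exact ⟨0, by simp [hf, taylorTerm]⟩
  by_contra! hne
  have hlt : ∀ i, v.val (taylorTerm b f i) < v.val (algebraMap K[X] (RatFunc K) f) := fun i =>
    lt_of_le_of_ne (h f i) (hne i).symm
  have := Valuation.map_sum_lt v.ring.valuation (s := (taylor b f).support)
    ((Valuation.ne_zero_iff _).2 (RatFunc.algebraMap_ne_zero hf)) fun i _ => hlt i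
  rw [sum_taylorTerm] at this
  exact lt_irrefl _ this

/-- For Gauss valuations, v f ≤ v g means that each Taylor term of f is bounded by some Taylor term
of g; comparisons of monomials therefore determine v. -/
theorem IsGaussAt.eq_of_val_le_iff {w : ValExt O} {b : K} (hv : v.IsGaussAt b)
    (hw : w.IsGaussAt b)
    (h : ∀ (a c : K) (i j : ℕ),
      v.val (RatFunc.C a * (RatFunc.X - RatFunc.C b) ^ i) ≤
        v.val (RatFunc.C c * (RatFunc.X - RatFunc.C b) ^ j) ↔
      w.val (RatFunc.C a * (RatFunc.X - RatFunc.C b) ^ i) ≤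
        w.val (RatFunc.C c * (RatFunc.X - RatFunc.C b) ^ j)) : v = w := by
  have key : ∀ {v : ValExt O}, v.IsGaussAt b → ∀ f g : K[X],
      (v.val (algebraMap K[X] (RatFunc K) f) ≤ v.val (algebraMap _ _ g) ↔
        ∀ i, ∃ j, v.val (taylorTerm b f i) ≤ v.val (taylorTerm b g j)) := by
    intro v hv f g
    rw [hv.val_le_iff]
    refine forall_congr' fun i => ⟨fun hi => ?_, fun ⟨j, hj⟩ => hj.trans (hv g j)⟩
    obtain ⟨j, hj⟩ := hv.exists_val_eq g
    exact ⟨j, hj ▸ hi⟩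
  refine ValExt.eq_of_val_le_iff fun f g => ?_
  rw [key hv, key hw]
  exact forall_congr' fun i => exists_congr fun j => h _ _ _ _

/-! ### Value-transcendental elements `x - b` -/

theorem IsValueTranscendentalElt.of_C_mul {d : K} {t : RatFunc K}
    (h : v.IsValueTranscendentalElt (RatFunc.C d * t)) : v.IsValueTranscendentalElt t := by
  refine ⟨right_ne_zero_of_mul h.1, fun n hn => ?_⟩
  rintro ⟨r, hr⟩
  refine h.2 n hn ⟨O.valuation d ^ n * r, ?_⟩
  rw [map_mul, map_pow, hr, val_mul, val_C, mul_pow]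

/-- Nonzero terms of different degrees have different values, because v(x - b) is not torsion modulo
v₀K; so the maximum is attained exactly once. -/
theorem IsValueTranscendentalElt.exists_dominant {b : K}
    (h : v.IsValueTranscendentalElt (RatFunc.X - RatFunc.C b)) {f : K[X]} (hf : f ≠ 0) :
    ∃ m, v.val (algebraMap K[X] (RatFunc K) f) = v.val (taylorTerm b f m) ∧
      (∀ i, v.val (taylorTerm b f i) ≤ v.val (taylorTerm b f m)) ∧
      v.val (algebraMap K[X] (RatFunc K) f - taylorTerm b f m) <
        v.val (algebraMap K[X] (RatFunc K) f) := by
  classical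
  have hf' : (taylor b f).support.Nonempty := by
    rw [Finset.nonempty_iff_ne_empty, Ne, support_eq_empty]
    exact fun h => hf (taylor_injective b (by simpa using h))
  obtain ⟨m, hm, hmax⟩ := Finset.exists_max_image _ (fun i => v.val (taylorTerm b f i)) hf'
  have hm0 : v.val (taylorTerm b f m) ≠ 0 := by
    rw [Valuation.ne_zero_iff]
    exact mul_ne_zero (by simpa using hm) (pow_ne_zero _ (X_sub_C_ne_zero b))
  have hlt : ∀ i ∈ (taylor b f).support \ {m},
      v.val (taylorTerm b f i) < v.val (taylorTerm b f m) := by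
    intro i hi
    rw [Finset.mem_sdiff, Finset.mem_singleton] at hi
    refine lt_of_le_of_ne (hmax i hi.1) fun e => hi.2 ?_
    have := h.exponent_eq (mem_support_iff.1 hi.1) (m := i) (n := m) (by simpa [taylorTerm] using e)
    exact_mod_cast this
  have hval : v.val (algebraMap K[X] (RatFunc K) f) = v.val (taylorTerm b f m) := by
    rw [← sum_taylorTerm b f]
    exact Valuation.map_sum_eq_of_lt _ hm hlt
  refine ⟨m, hval, fun i => ?_, ?_⟩
  · by_cases hi : i ∈ (taylor b f).support
    · exact hmax i hi
    · simp [taylorTerm, notMem_support_iff.1 hi]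
  · rw [hval]
    have e : algebraMap K[X] (RatFunc K) f - taylorTerm b f m =
        ∑ i ∈ (taylor b f).support \ {m}, taylorTerm b f i := by
      rw [← sum_taylorTerm b f, Finset.sum_eq_add_sum_sdiff_singleton_of_mem hm, add_sub_cancel_left]
    rw [e]
    exact Valuation.map_sum_lt _ hm0 hlt

theorem IsValueTranscendentalElt.isGaussAt {b : K}
    (h : v.IsValueTranscendentalElt (RatFunc.X - RatFunc.C b)) : v.IsGaussAt b := by
  intro f i
  by_cases hf : f = 0
  · simp [hf, taylorTerm]
  obtain ⟨m, h1, h2, -⟩ := h.exists_dominant hf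
  rw [h1]
  exact h2 i

theorem IsValueTranscendentalElt.isValueTranscendental {b : K}
    (h : v.IsValueTranscendentalElt (RatFunc.X - RatFunc.C b)) : v.IsValueTranscendental := by
  refine v.isValueTranscendental_of_forall_exists h (v.exists_approx_of_polynomial h.1 ?_)
  intro f hf
  obtain ⟨m, -, -, h3⟩ := h.exists_dominant hf
  exact ⟨(taylor b f).coeff m, m, by rwa [zpow_natCast]⟩

end ValExt

/-! ### Residue-transcendental elements d(x - b) -/

/-- Dividing by a coefficient of maximal value makes all coefficients integral and one of them equal
to 1. -/
theorem ValuationSubring.exists_primitive_factorization {K : Type*} [Field K]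
    (O : ValuationSubring K) {g : K[X]} (hg : g ≠ 0) :
    ∃ e : K, e ≠ 0 ∧ ∃ Q : O[X], C e * Q.map O.subtype = g ∧ Q.map (IsLocalRing.residue O) ≠ 0 := by
  obtain ⟨m, hm, hmax⟩ := Finset.exists_max_image g.support (fun i => O.valuation (g.coeff i))
    (by rwa [Finset.nonempty_iff_ne_empty, Ne, support_eq_empty])
  have he : g.coeff m ≠ 0 := mem_support_iff.1 hm
  have hpos : 0 < O.valuation (g.coeff m) := zero_lt_iff.2 ((Valuation.ne_zero_iff _).2 he)
  have hlift : C (g.coeff m)⁻¹ * g ∈ lifts O.subtype := by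
    rw [lifts_iff_coeff_lifts]
    intro n
    have hn : (C (g.coeff m)⁻¹ * g).coeff n ∈ O := by
      rw [coeff_C_mul, ← ValuationSubring.valuation_le_one_iff, map_mul, map_inv₀,
        inv_mul_le_iff₀ hpos, mul_one]
      by_cases hn : n ∈ g.support
      · exact hmax n hn
      · simp [notMem_support_iff.1 hn]
    exact ⟨⟨_, hn⟩, rfl⟩
  obtain ⟨Q, hQ⟩ := hlift
  rw [coe_mapRingHom] at hQ
  refine ⟨g.coeff m, he, Q, ?_, fun h0 => ?_⟩
  · rw [hQ, ← mul_assoc, ← C_mul, mul_inv_cancel₀ he, C_1, one_mul]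
  · have h1 := congrArg (fun p => p.coeff m) h0
    simp only [coeff_map, coeff_zero, IsLocalRing.residue_eq_zero_iff,
      ValuationSubring.valuation_lt_one_iff] at h1
    have h2 : (Q.coeff m : K) = 1 := by
      have h3 := congrArg (fun p => p.coeff m) hQ
      simp only [coeff_map, coeff_C_mul, inv_mul_cancel₀ he] at h3
      exact h3
    rw [h2, map_one] at h1
    exact lt_irrefl _ h1

namespace ValExt

variable {K : Type*} [Field K] {O : ValuationSubring K} {v : ValExt O}

theorem residue_eval₂ (t : v.ring) (Q : O[X]) :
    IsLocalRing.residue v.ring (Q.eval₂ v.ringMap t) =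
      aeval (IsLocalRing.residue v.ring t) (Q.map (IsLocalRing.residue O)) := by
  rw [hom_eval₂, aeval_def, eval₂_map]
  rfl

theorem coe_eval₂ (t : v.ring) (Q : O[X]) :
    ((Q.eval₂ v.ringMap t : v.ring) : RatFunc K) = aeval (t : RatFunc K) (Q.map O.subtype) := by
  change v.ring.subtype _ = _
  rw [hom_eval₂, aeval_def, eval₂_map]
  rfl

/-- The change of variable x = d⁻¹ t + b, which turns f into a polynomial in t = d(x - b). -/
theorem aeval_comp_taylor {b d : K} (hd : d ≠ 0) (f : K[X]) :
    aeval (RatFunc.C d * (RatFunc.X - RatFunc.C b)) ((taylor b f).comp (C d⁻¹ * Polynomial.X)) =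
      algebraMap K[X] (RatFunc K) f := by
  have hd' : RatFunc.C d ≠ 0 := by simpa using hd
  rw [aeval_comp, taylor_apply, aeval_comp, ← RatFunc.aeval_X_left_eq_algebraMap]
  congr 1
  simp only [map_mul, map_add, aeval_X, aeval_C, RatFunc.algebraMap_eq_C]
  congr 1
  rw [map_inv₀, inv_mul_cancel_left₀ hd', sub_add_cancel]

/-- The residue of Q(t) is the reduction of Q evaluated at a transcendental element, hence nonzero.
-/
theorem val_eval₂_eq_one {t : v.ring}
    (ht : Transcendental (IsLocalRing.ResidueField O) (IsLocalRing.residue v.ring t)) {Q : O[X]}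
    (hQ : Q.map (IsLocalRing.residue O) ≠ 0) :
    v.val (Q.eval₂ v.ringMap t : v.ring) = 1 := by
  rcases v.ring.valuation_lt_one_or_eq_one (Q.eval₂ v.ringMap t) with h | h
  · rw [← ValuationSubring.valuation_lt_one_iff, ← IsLocalRing.residue_eq_zero_iff,
      residue_eval₂] at h
    exact absurd (transcendental_iff.1 ht _ h) hQ
  · exact h

namespace IsResidueTranscendentalElt

variable {b d : K}
  (h : v.IsResidueTranscendentalElt (RatFunc.C d * (RatFunc.X - RatFunc.C b)))
include h

theorem coeff_ne_zero : d ≠ 0 := by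
  rintro rfl
  have := h.1
  rw [map_zero, zero_mul, val_zero] at this
  exact zero_ne_one this

/-- Writing f = e Q(t) with Q primitive gives Q(t) the value 1, while the Taylor terms of f are e
q_i t^i with q_i integral and v t = 1. Both the Gauss property and the absence of new values follow.
-/
theorem exists_normal_form {f : K[X]} (hf : f ≠ 0) :
    ∃ e : K, e ≠ 0 ∧ ∃ Q : O[X], Q.map (IsLocalRing.residue O) ≠ 0 ∧
      algebraMap K[X] (RatFunc K) f = RatFunc.C e * (Q.eval₂ v.ringMap ⟨_, h.2.1⟩ : v.ring) ∧
      v.val (algebraMap K[X] (RatFunc K) f) = v.val (RatFunc.C e) ∧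
      ∀ i, v.val (taylorTerm b f i) ≤ v.val (RatFunc.C e) := by
  have hd := h.coeff_ne_zero
  have hg : (taylor b f).comp (C d⁻¹ * Polynomial.X) ≠ 0 := by
    intro h0
    have := aeval_comp_taylor (b := b) hd f
    rw [h0, map_zero, eq_comm] at this
    exact RatFunc.algebraMap_ne_zero hf this
  obtain ⟨e, he, Q, hQ, hres⟩ := O.exists_primitive_factorization hg
  have hf' : algebraMap K[X] (RatFunc K) f =
      RatFunc.C e * (Q.eval₂ v.ringMap ⟨_, h.2.1⟩ : v.ring) := by
    rw [coe_eval₂, ← aeval_comp_taylor (b := b) hd f, ← hQ, map_mul, aeval_C,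
      RatFunc.algebraMap_eq_C]
  refine ⟨e, he, Q, hres, hf', ?_, fun i => ?_⟩
  · rw [hf', val_mul, val_eval₂_eq_one h.2.2 hres, mul_one]
  · have hi := congrArg (fun p => p.coeff i) hQ
    simp only [coeff_C_mul, coeff_map, comp_C_mul_X_coeff] at hi
    have hi' : (taylor b f).coeff i = e * (Q.coeff i : K) * d ^ i := by
      rw [eq_comm, ← eq_div_iff (pow_ne_zero i hd)]
      refine Eq.trans hi ?_
      rw [inv_pow, div_eq_mul_inv]
    have e1 : taylorTerm b f i = RatFunc.C e * RatFunc.C (Q.coeff i : K) *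
        (RatFunc.C d * (RatFunc.X - RatFunc.C b)) ^ i := by
      rw [taylorTerm, hi', map_mul, map_mul, map_pow, mul_pow]
      ring
    rw [e1, val_mul, val_pow, h.1, one_pow, mul_one, val_mul]
    refine mul_le_of_le_one_right' ?_
    rw [val_C, ← map_one v.valueMap, valueMap_le_iff]
    exact O.valuation_le_one _

theorem isGaussAt : v.IsGaussAt b := by
  intro f i
  by_cases hf : f = 0
  · simp [hf, taylorTerm]
  obtain ⟨e, -, Q, -, -, h2, h3⟩ := h.exists_normal_form hf
  rw [h2]
  exact h3 i

theorem valueMap_surjective : Function.Surjective v.valueMap := by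
  have key : ∀ f : K[X], v.val (algebraMap K[X] (RatFunc K) f) ∈ Set.range v.valueMap := by
    intro f
    by_cases hf : f = 0
    · exact ⟨0, by simp [hf]⟩
    obtain ⟨e, -, Q, -, -, h2, -⟩ := h.exists_normal_form hf
    exact ⟨_, by rw [h2, val_C]⟩
  intro r
  obtain ⟨f, rfl⟩ := v.ring.valuation_surjective r
  obtain ⟨r, hr⟩ := key f.num
  obtain ⟨s, hs⟩ := key f.denom
  exact ⟨r / s, by rw [map_div₀, hr, hs, ← val_div, RatFunc.num_div_denom]⟩

/-- In denominator-free form, every residue is a rational function of the residue of t. The normal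
forms e P(t) and e' Q(t) of numerator and denominator give it, with e / e' integral because f is. -/
theorem exists_residue_mul_eq (y : IsLocalRing.ResidueField v.ring) :
    ∃ p q : (IsLocalRing.ResidueField O)[X], q ≠ 0 ∧
      y * aeval (IsLocalRing.residue v.ring ⟨_, h.2.1⟩) q =
        aeval (IsLocalRing.residue v.ring ⟨_, h.2.1⟩) p := by
  obtain ⟨⟨f, hf⟩, rfl⟩ := IsLocalRing.residue_surjective y
  by_cases hf0 : f = 0
  · subst hf0
    refine ⟨0, 1, one_ne_zero, ?_⟩
    rw [map_zero, map_one, mul_one]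
    exact map_zero _
  obtain ⟨e, he, P, hP, h1, h2, -⟩ := h.exists_normal_form (RatFunc.num_ne_zero hf0)
  obtain ⟨e', he', Q, hQ, h1', h2', -⟩ := h.exists_normal_form f.denom_ne_zero
  have hee : e / e' ∈ O := by
    rw [← mem_iff v, RatFunc.algebraMap_eq_C, ← ValuationSubring.valuation_le_one_iff]
    have := (ValuationSubring.valuation_le_one_iff _ _).2 hf
    rw [← RatFunc.num_div_denom f, map_div₀] at this
    change v.val _ / v.val _ ≤ 1 at this
    rw [h2, h2', ← val_div] at this
    rwa [map_div₀ RatFunc.C]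
  refine ⟨C (IsLocalRing.residue O ⟨e / e', hee⟩) * P.map (IsLocalRing.residue O),
    Q.map (IsLocalRing.residue O), hQ, ?_⟩
  have e0 : C (IsLocalRing.residue O ⟨e / e', hee⟩) * P.map (IsLocalRing.residue O) =
      (C (⟨e / e', hee⟩ : O) * P).map (IsLocalRing.residue O) := by
    rw [Polynomial.map_mul, map_C]
  rw [e0, ← residue_eval₂, ← residue_eval₂, ← map_mul]
  congr 1
  apply Subtype.ext
  rw [eval₂_mul, eval₂_C]
  change f * _ = RatFunc.C (e / e') * _
  have hd0 : algebraMap K[X] (RatFunc K) f.denom ≠ 0 :=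
    RatFunc.algebraMap_ne_zero f.denom_ne_zero
  have he'' : RatFunc.C e' ≠ 0 := by simpa using he'
  have h3 := RatFunc.num_div_denom f
  rw [div_eq_iff hd0, h1, h1'] at h3
  rw [map_div₀ RatFunc.C, div_mul_eq_mul_div, eq_div_iff he'', h3]
  ring

theorem trdeg_eq_one :
    Algebra.trdeg (IsLocalRing.ResidueField O) (IsLocalRing.ResidueField v.ring) = 1 := by
  set τ := IsLocalRing.residue v.ring ⟨_, h.2.1⟩ with hτ
  apply le_antisymm
  · have : Algebra.IsAlgebraic (Algebra.adjoin (IsLocalRing.ResidueField O) {τ})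
        (IsLocalRing.ResidueField v.ring) := by
      constructor
      intro y
      obtain ⟨p, q, hq, e⟩ := h.exists_residue_mul_eq y
      have hmem : ∀ p : (IsLocalRing.ResidueField O)[X], aeval τ p ∈
          Algebra.adjoin (IsLocalRing.ResidueField O) {τ} := fun p =>
        aeval_mem_adjoin_singleton _ _
      -- The linear polynomial q(τ) Y - p(τ) annihilates y, and its leading coefficient is nonzero
      -- since τ is transcendental.
      refine ⟨C ⟨_, hmem q⟩ * X - C ⟨_, hmem p⟩, fun h0 => hq ?_, ?_⟩
      · have h1 := congrArg (fun p => p.coeff 1) h0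
        simp only [coeff_sub, coeff_C_mul, coeff_X_one, mul_one, coeff_C_succ, sub_zero,
          coeff_zero] at h1
        exact transcendental_iff.1 h.2.2 q (congrArg Subtype.val h1)
      · rw [map_sub, map_mul, aeval_C, aeval_C, aeval_X, mul_comm]
        exact sub_eq_zero.2 e
    have h1 := Algebra.IsAlgebraic.trdeg_le_cardinalMk (IsLocalRing.ResidueField O) {τ}
    rwa [Cardinal.mk_singleton] at h1
  · have : Algebra.Transcendental (IsLocalRing.ResidueField O)
        (IsLocalRing.ResidueField v.ring) := ⟨τ, h.2.2⟩
    exact Cardinal.one_le_iff_pos.2 (trdeg_pos _ _)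

theorem isResidueTranscendental : v.IsResidueTranscendental := by
  refine ⟨h.trdeg_eq_one, fun q => ?_⟩
  have := v.subsingleton_valueQuotient h.valueMap_surjective
  rw [Subsingleton.elim q 1]
  exact IsOfFinOrder.one

end IsResidueTranscendentalElt

end ValExt

/-! ### Immediate approximation types and the filter of their balls -/

namespace ApproxType

variable {K : Type*} [Field K] {O : ValuationSubring K} {A : ApproxType O}

theorem mem_closed_iff {r : O.ValueGroup} {c a : K} (hc : c ∈ A.closed r) :
    a ∈ A.closed r ↔ O.valuation (a - c) ≤ r := by
  rw [A.closed_of_closed r r c hc le_rfl]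
  rfl

theorem mem_supp_of_mem_opn {r : O.ValueGroup} {c : K} (hc : c ∈ A.opn r) : r ∈ A.supp :=
  ⟨c, by rw [A.closed_of_opn r r c hc le_rfl]; simp [closedValBall]⟩

theorem ne_zero_of_mem_opn {r : O.ValueGroup} {c : K} (hc : c ∈ A.opn r) : r ≠ 0 := by
  rintro rfl
  have h := hc
  rw [A.opn_of_opn 0 0 c hc le_rfl] at h
  simp [openValBall] at h

theorem closed_mono {r s : O.ValueGroup} (hr : r ∈ A.supp) (hrs : r ≤ s) :
    A.closed r ⊆ A.closed s := by
  obtain ⟨c, hc⟩ := hr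
  intro a ha
  rw [A.closed_of_closed r s c hc hrs]
  exact ((mem_closed_iff hc).1 ha).trans hrs

theorem supp_of_le {r s : O.ValueGroup} (hr : r ∈ A.supp) (hrs : r ≤ s) : s ∈ A.supp :=
  hr.mono (closed_mono hr hrs)

/-- Without a smallest closed ball, each open ball of the nest is determined by a closed ball of
smaller radius. -/
theorem ext_of_closed {A B : ApproxType O} (h : A.closed = B.closed)
    (hA : ∀ r ∈ A.supp, ∃ s ∈ A.supp, s < r) : A = B := by
  have hB : ∀ r ∈ B.supp, ∃ s ∈ B.supp, s < r := by
    have : B.supp = A.supp := by ext r; simp [supp, h]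
    rwa [this]
  refine ApproxType.ext h (funext fun r => Set.Subset.antisymm ?_ ?_) <;> intro c hc
  · obtain ⟨s, ⟨d, hd⟩, hs⟩ := hA r (mem_supp_of_mem_opn hc)
    rw [A.opn_of_closed s r d hd hs] at hc
    rw [h] at hd
    rwa [B.opn_of_closed s r d hd hs]
  · obtain ⟨s, ⟨d, hd⟩, hs⟩ := hB r (mem_supp_of_mem_opn hc)
    rw [B.opn_of_closed s r d hd hs] at hc
    rw [← h] at hd
    rwa [A.opn_of_closed s r d hd hs]

namespace IsImmediate

variable (hA : A.IsImmediate)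
include hA

/-- If the support had a least radius r, a point of the open ball of radius r, or of the closed one
when the nest has no such open ball, would lie in all balls. -/
theorem exists_lt {r : O.ValueGroup} (hr : r ∈ A.supp) : ∃ s ∈ A.supp, s < r := by
  by_contra! hmin
  by_cases ho : (A.opn r).Nonempty
  · obtain ⟨c, hc⟩ := ho
    have : c ∈ A.inter := by
      refine ⟨fun s hs => ?_, fun s ⟨a, ha⟩ => ?_⟩
      · rw [A.closed_of_opn r s c hc (hmin s hs)]
        simp [closedValBall]
      · rw [A.opn_of_opn r s c hc (hmin s (mem_supp_of_mem_opn ha))]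
        simpa [openValBall] using zero_lt_iff.2 (ne_zero_of_mem_opn ha)
    rw [hA.2] at this
    exact this
  · obtain ⟨c, hc⟩ := hr
    have : c ∈ A.inter := by
      refine ⟨fun s hs => ?_, fun s ⟨a, ha⟩ => ?_⟩
      · rw [A.closed_of_closed r s c hc (hmin s hs)]
        simp [closedValBall]
      · have hrs : r < s := lt_of_le_of_ne (hmin s (mem_supp_of_mem_opn ha)) (by
          rintro rfl
          exact ho ⟨a, ha⟩)
        rw [A.opn_of_closed r s c hc hrs]
        simpa [openValBall] using lt_of_le_of_lt zero_le hrs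
    rw [hA.2] at this
    exact this

/-- Open balls do not matter for the intersection, since each of them contains a closed ball of
smaller radius from the nest. -/
theorem exists_notMem_closed (c : K) : ∃ s ∈ A.supp, c ∉ A.closed s := by
  by_contra! h
  have : c ∈ A.inter := by
    refine ⟨fun s hs => h s hs, fun s ⟨a, ha⟩ => ?_⟩
    obtain ⟨t, ht, hts⟩ := hA.exists_lt (mem_supp_of_mem_opn ha)
    rw [A.opn_of_closed t s c (h t ht) hts]
    simpa [openValBall] using lt_of_le_of_lt zero_le hts
  rw [hA.2] at this
  exact this

theorem zero_notMem_supp : 0 ∉ A.supp := fun h => by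
  obtain ⟨s, -, hs⟩ := hA.exists_lt h
  exact absurd hs (not_lt.2 zero_le)

end IsImmediate

/-- The filter generated by the closed balls of `A`. -/
def limitFilter (A : ApproxType O) : Filter K := ⨅ r : A.supp, Filter.principal (A.closed r)

theorem eventually_limitFilter (hA : A.supp.Nonempty) {p : K → Prop} :
    (∀ᶠ c in A.limitFilter, p c) ↔ ∃ r ∈ A.supp, ∀ c ∈ A.closed r, p c := by
  have := hA.to_subtype
  rw [Filter.Eventually, limitFilter, Filter.mem_iInf_of_directed]
  · simp [Set.subset_def]
  · intro r s
    rcases le_total (r : O.ValueGroup) s with h | h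
    · exact ⟨r, le_rfl, Filter.principal_mono.2 (closed_mono r.2 h)⟩
    · exact ⟨s, Filter.principal_mono.2 (closed_mono s.2 h), le_rfl⟩

theorem eventually_mem_closed {r : O.ValueGroup} (hr : r ∈ A.supp) :
    ∀ᶠ c in A.limitFilter, c ∈ A.closed r :=
  (eventually_limitFilter ⟨r, hr⟩).2 ⟨r, hr, fun _ h => h⟩

theorem limitFilter_neBot (hA : A.supp.Nonempty) : A.limitFilter.NeBot := by
  rw [Filter.neBot_iff]
  intro h
  have : ∀ᶠ c in A.limitFilter, False := by rw [h]; exact Filter.eventually_bot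
  obtain ⟨r, ⟨c, hc⟩, h⟩ := (eventually_limitFilter hA).1 this
  exact h c hc

theorem fixesValue_iff (hA : A.supp.Nonempty) {f : K[X]} :
    A.FixesValue f ↔ ∃ β, ∀ᶠ c in A.limitFilter, O.valuation (f.eval c) = β := by
  simp only [eventually_limitFilter hA]
  constructor
  · rintro ⟨r, hr, β, h⟩
    exact ⟨β, r, hr, h⟩
  · rintro ⟨β, r, hr, h⟩
    exact ⟨r, hr, β, h⟩

/-- `A` fixes the value of every polynomial, or makes it arbitrarily small. -/
def FixesOrVanishes (A : ApproxType O) : Prop :=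
  ∀ f : K[X], (∃ β, β ≠ 0 ∧ ∀ᶠ c in A.limitFilter, O.valuation (f.eval c) = β) ∨
    ∀ r, r ≠ 0 → ∀ᶠ c in A.limitFilter, O.valuation (f.eval c) < r

/-- Each of the finitely many roots is missed by some ball. -/
theorem IsImmediate.eventually_eval_ne_zero (hA : A.IsImmediate) {f : K[X]} (hf : f ≠ 0) :
    ∀ᶠ c in A.limitFilter, f.eval c ≠ 0 := by
  classical
  have h : ∀ b : K, ∀ᶠ c in A.limitFilter, c ≠ b := by
    intro b
    obtain ⟨s, hs, hb⟩ := hA.exists_notMem_closed b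
    filter_upwards [eventually_mem_closed hs] with c hc
    rintro rfl
    exact hb hc
  have h2 : ∀ᶠ c in A.limitFilter, ∀ b ∈ f.roots.toFinset, c ≠ b :=
    (Filter.eventually_all_finset _).2 fun b _ => h b
  filter_upwards [h2] with c hc h0
  exact hc c (by simpa [hf] using h0) rfl

theorem IsTranscendentalImmediate.exists_value (hA : A.IsTranscendentalImmediate) {f : K[X]}
    (hf : f ≠ 0) : ∃ β, β ≠ 0 ∧ ∀ᶠ c in A.limitFilter, O.valuation (f.eval c) = β := by
  obtain ⟨β, hβ⟩ := (fixesValue_iff hA.1.1).1 (hA.2 f)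
  refine ⟨β, ?_, hβ⟩
  have := limitFilter_neBot hA.1.1
  obtain ⟨c, hc, hc'⟩ := (hβ.and (hA.1.eventually_eval_ne_zero hf)).exists
  rw [← hc]
  exact (Valuation.ne_zero_iff _).2 hc'

theorem IsTranscendentalImmediate.fixesOrVanishes (hA : A.IsTranscendentalImmediate) :
    A.FixesOrVanishes := by
  intro f
  by_cases hf : f = 0
  · exact Or.inr fun r hr => Filter.Eventually.of_forall fun c => by
      simpa [hf] using zero_lt_iff.2 hr
  · exact Or.inl (hA.exists_value hf)

end ApproxType

/-! ### Lipschitz bounds and the limit valuation -/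

/-- Polynomial maps are bounded and Lipschitz on bounded sets. -/
theorem Polynomial.exists_lipschitz {K L Γ : Type*} [Field K] [Field L] [Algebra K L]
    [LinearOrderedCommGroupWithZero Γ] (w : Valuation L Γ) {M : K} (f : K[X]) :
    ∃ B : K, B ≠ 0 ∧ ∀ y z : L, w y ≤ w (algebraMap K L M) → w z ≤ w (algebraMap K L M) →
      w (aeval y f) ≤ w (algebraMap K L B) ∧
      w (aeval y f - aeval z f) ≤ w (algebraMap K L B) * w (y - z) := by
  -- The constant is chosen in K, so that the bound is a nonzero value from v₀K even when L = K(x).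
  have max_exists : ∀ a b : K, b ≠ 0 → ∃ B : K, B ≠ 0 ∧
      w (algebraMap K L a) ≤ w (algebraMap K L B) ∧ w (algebraMap K L b) ≤ w (algebraMap K L B) := by
    intro a b hb
    rcases le_total (w (algebraMap K L a)) (w (algebraMap K L b)) with h | h
    · exact ⟨b, hb, h, le_rfl⟩
    · refine ⟨a, ?_, le_rfl, h⟩
      rintro rfl
      rw [map_zero, map_zero, le_zero_iff, Valuation.zero_iff] at h
      exact hb (by simpa using h)
  induction f using Polynomial.induction_on' with
  | add p q hp hq =>
    obtain ⟨B, hB, h1⟩ := hp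
    obtain ⟨B', hB', h2⟩ := hq
    obtain ⟨D, hD, hBD, hBD'⟩ := max_exists B B' hB'
    refine ⟨D, hD, fun y z hy hz => ?_⟩
    obtain ⟨h3, h4⟩ := h1 y z hy hz
    obtain ⟨h5, h6⟩ := h2 y z hy hz
    constructor
    · rw [map_add]
      exact w.map_add_le (h3.trans hBD) (h5.trans hBD')
    · rw [map_add, map_add, add_sub_add_comm]
      exact w.map_add_le (h4.trans (mul_le_mul_left hBD _)) (h6.trans (mul_le_mul_left hBD' _))
  | monomial n a =>
    induction n with
    | zero =>
      obtain ⟨B, hB, h1, -⟩ := max_exists a 1 one_ne_zero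
      exact ⟨B, hB, fun y z _ _ => ⟨by simpa using h1, by simp⟩⟩
    | succ n ih =>
      obtain ⟨B, hB, h1⟩ := ih
      obtain ⟨D, hD, h2, h3⟩ := max_exists (B * M) B hB
      refine ⟨D, hD, fun y z hy hz => ?_⟩
      obtain ⟨h4, h5⟩ := h1 y z hy hz
      have h6 := (h1 z y hz hy).1
      have e : ∀ y : L, aeval y (monomial (n + 1) a) = aeval y (monomial n a) * y := by
        intro y
        rw [aeval_monomial, aeval_monomial, pow_succ, mul_assoc]
      rw [map_mul, map_mul] at h2
      constructor
      · rw [e, map_mul]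
        exact (mul_le_mul' h4 hy).trans h2
      · rw [e, e]
        have e2 : aeval y (monomial n a) * y - aeval z (monomial n a) * z =
            (aeval y (monomial n a) - aeval z (monomial n a)) * y +
              aeval z (monomial n a) * (y - z) := by ring
        rw [e2]
        apply w.map_add_le
        · rw [map_mul]
          calc _ ≤ (w (algebraMap K L B) * w (y - z)) * w (algebraMap K L M) := mul_le_mul' h5 hy
            _ = (w (algebraMap K L B) * w (algebraMap K L M)) * w (y - z) := mul_right_comm _ _ _
            _ ≤ _ := mul_le_mul_left h2 _
        · rw [map_mul]
          exact mul_le_mul_left (h6.trans h3) _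

namespace ApproxType

variable {K : Type*} [Field K] {O : ValuationSubring K} {A : ApproxType O}

theorem IsCompletionType.mem_supp (hA : A.IsCompletionType) {r : O.ValueGroup} (hr : r ≠ 0) :
    r ∈ A.supp := by
  rw [hA.2]
  exact hr

/-- A completion type lies in a bounded set. -/
theorem IsCompletionType.exists_bound (hA : A.IsCompletionType) :
    ∃ c M : K, c ∈ A.closed 1 ∧ M ≠ 0 ∧ 1 ≤ O.valuation M ∧ O.valuation c ≤ O.valuation M ∧
      ∀ᶠ c in A.limitFilter, O.valuation c ≤ O.valuation M := by
  have h1 : (1 : O.ValueGroup) ∈ A.supp := hA.mem_supp one_ne_zero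
  obtain ⟨c, hc⟩ := id h1
  obtain ⟨M, hM1, hcM⟩ : ∃ M : K, 1 ≤ O.valuation M ∧ O.valuation c ≤ O.valuation M := by
    rcases le_total (O.valuation c) 1 with h | h
    · exact ⟨1, by simp, by simpa using h⟩
    · exact ⟨c, h, le_rfl⟩
  refine ⟨c, M, hc, ?_, hM1, hcM, ?_⟩
  · rintro rfl
    simp at hM1
  · filter_upwards [eventually_mem_closed h1] with a ha
    rw [mem_closed_iff hc] at ha
    have := O.valuation.map_add_le (ha.trans hM1) hcM
    simpa using this

/-- If f does not become small, there are points c arbitrarily deep in the nest with v₀ f(c) ≥ r in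
the multiplicative order. On a ball of radius below r / B, with B the Lipschitz constant, f varies
by less than r, so its value is constant there. -/
theorem IsCompletionType.fixesOrVanishes (hA : A.IsCompletionType) : A.FixesOrVanishes := by
  intro f
  rw [or_iff_not_imp_right]
  intro h
  push Not at h
  obtain ⟨r, hr, hfr⟩ := h
  obtain ⟨-, M, -, hM0, -, -, hM⟩ := hA.exists_bound
  obtain ⟨B, hB, hL⟩ := Polynomial.exists_lipschitz O.valuation (M := M) f
  have hB' : 0 < O.valuation B := zero_lt_iff.2 ((Valuation.ne_zero_iff _).2 hB)
  obtain ⟨s, hs, hsr⟩ := hA.1.exists_lt (hA.mem_supp (r := r / O.valuation B)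
    (div_ne_zero hr hB'.ne'))
  obtain ⟨c, hfc, hcs, hcM⟩ :=
    (hfr.and_eventually ((eventually_mem_closed hs).and hM)).exists
  refine ⟨O.valuation (f.eval c), (lt_of_lt_of_le (zero_lt_iff.2 hr) hfc).ne', ?_⟩
  filter_upwards [eventually_mem_closed hs, hM] with a ha haM
  have h1 := (hL a c haM hcM).2
  rw [mem_closed_iff hcs] at ha
  apply Valuation.map_eq_of_sub_lt
  refine lt_of_lt_of_le ?_ hfc
  rw [Polynomial.coe_aeval_eq_eval, Polynomial.coe_aeval_eq_eval] at h1
  refine lt_of_le_of_lt (h1.trans (mul_le_mul_right ha _)) ?_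
  rw [lt_div_iff₀ hB', mul_comm] at hsr
  exact hsr

namespace FixesOrVanishes

variable (hD : A.FixesOrVanishes)
include hD

theorem exists_bound (f : K[X]) :
    ∃ β, β ≠ 0 ∧ ∀ᶠ c in A.limitFilter, O.valuation (f.eval c) ≤ β := by
  rcases hD f with ⟨β, hβ, h⟩ | h
  · exact ⟨β, hβ, h.mono fun _ hc => hc.le⟩
  · exact ⟨1, one_ne_zero, (h 1 one_ne_zero).mono fun _ hc => hc.le⟩

/-- In a Bézout identity af + bg = 1 the cofactors stay bounded near the nest, so f and g cannot
both tend to 0. -/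
theorem not_vanishes_of_isCoprime (hA : A.supp.Nonempty) {f g : K[X]} (h : IsCoprime f g)
    (hf : ∀ r, r ≠ 0 → ∀ᶠ c in A.limitFilter, O.valuation (f.eval c) < r)
    (hg : ∀ r, r ≠ 0 → ∀ᶠ c in A.limitFilter, O.valuation (g.eval c) < r) : False := by
  obtain ⟨a, b, hab⟩ := h
  obtain ⟨α, hα, ha⟩ := hD.exists_bound a
  obtain ⟨β, hβ, hb⟩ := hD.exists_bound b
  have := limitFilter_neBot hA
  obtain ⟨c, h1, h2, h3, h4⟩ := ((hf α⁻¹ (inv_ne_zero hα)).and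
    ((hg β⁻¹ (inv_ne_zero hβ)).and (ha.and hb))).exists
  have e := congrArg (eval c) hab
  rw [eval_add, eval_mul, eval_mul, eval_one] at e
  have : O.valuation (1 : K) < 1 := by
    rw [← e]
    have key : ∀ {x y α : O.ValueGroup}, α ≠ 0 → x ≤ α → y < α⁻¹ → x * y < 1 := by
      intro x y α hα hx hy
      calc x * y ≤ α * y := mul_le_mul_left hx _
        _ < α * α⁻¹ := mul_lt_mul_of_pos_left hy (zero_lt_iff.2 hα)
        _ = 1 := mul_inv_cancel₀ hα
    apply O.valuation.map_add_lt <;> rw [map_mul]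
    · exact key hα h3 h1
    · exact key hβ h4 h2
  simp at this

/-- Comparison of the values of two coprime polynomials near `A`. -/
theorem eventually_le_or_le (hA : A.supp.Nonempty) {f g : K[X]} (h : IsCoprime f g) :
    (∀ᶠ c in A.limitFilter, O.valuation (f.eval c) ≤ O.valuation (g.eval c)) ∨
      ∀ᶠ c in A.limitFilter, O.valuation (g.eval c) ≤ O.valuation (f.eval c) := by
  rcases hD f with ⟨β, hβ, hf⟩ | hf <;> rcases hD g with ⟨γ, hγ, hg⟩ | hg
  · rcases le_total β γ with hle | hle
    · left
      filter_upwards [hf, hg] with c h1 h2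
      rwa [h1, h2]
    · right
      filter_upwards [hf, hg] with c h1 h2
      rwa [h1, h2]
  · right
    filter_upwards [hf, hg β hβ] with c h1 h2
    rw [h1]
    exact h2.le
  · left
    filter_upwards [hg, hf γ hγ] with c h1 h2
    rw [h1]
    exact h2.le
  · exact (hD.not_vanishes_of_isCoprime hA h hf hg).elim

end FixesOrVanishes

/-- The elements of `K(x)` which are eventually integral at the points near `A` form the
valuation ring of an extension. -/
def limitExt (A : ApproxType O) (hA : A.IsImmediate) (hD : A.FixesOrVanishes) : ValExt O where
  ring :=
    { carrier := {f | ∀ᶠ c in A.limitFilter, O.valuation (f.eval (RingHom.id K) c) ≤ 1}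
      mul_mem' := fun {f g} hf hg => by
        -- Evaluation of rational functions is compatible with the operations only off the zeros of
        -- the denominators, which are eventually avoided.
        filter_upwards [hf, hg, hA.eventually_eval_ne_zero f.denom_ne_zero,
          hA.eventually_eval_ne_zero g.denom_ne_zero] with c h1 h2 h3 h4
        rw [RatFunc.eval_mul (f := RingHom.id K) (a := c) h3 h4, map_mul]
        exact mul_le_one' h1 h2
      one_mem' := by simp
      add_mem' := fun {f g} hf hg => by
        filter_upwards [hf, hg, hA.eventually_eval_ne_zero f.denom_ne_zero,
          hA.eventually_eval_ne_zero g.denom_ne_zero] with c h1 h2 h3 h4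
        rw [RatFunc.eval_add (f := RingHom.id K) (a := c) h3 h4]
        exact O.valuation.map_add_le h1 h2
      zero_mem' := by simp
      neg_mem' := fun {f} hf => by
        filter_upwards [hf, hA.eventually_eval_ne_zero f.denom_ne_zero] with c h1 h2
        have e : -f = RatFunc.C (-1) * f := by simp
        rw [e, RatFunc.eval_mul (f := RingHom.id K) (a := c) (by rw [RatFunc.denom_C]; simp) h2,
          RatFunc.eval_C, RingHom.id_apply, neg_one_mul, Valuation.map_neg]
        exact h1
      mem_or_inv_mem' := fun f => by
        by_cases hf : f = 0
        · left
          simp [hf]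
        have hden := hA.eventually_eval_ne_zero f.denom_ne_zero
        have hnum := hA.eventually_eval_ne_zero (RatFunc.num_ne_zero hf)
        have hval : ∀ c, f.eval (RingHom.id K) c = f.num.eval c / f.denom.eval c := fun c => rfl
        -- Numerator and denominator are coprime, so near the nest one of them eventually bounds the
        -- other: f or its inverse is eventually integral.
        rcases hD.eventually_le_or_le hA.1 f.isCoprime_num_denom with h | h
        · left
          filter_upwards [h, hden] with c h1 h2
          rw [hval, map_div₀]
          exact div_le_one_of_le₀ h1 zero_le
        · right
          filter_upwards [h, hden, hnum,
            hA.eventually_eval_ne_zero f⁻¹.denom_ne_zero] with c h1 h2 h3 h4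
          have e := RatFunc.eval_mul (f := RingHom.id K) (a := c) (x := f) (y := f⁻¹) h2 h4
          rw [mul_inv_cancel₀ hf, RatFunc.eval_one, hval] at e
          have e2 : f⁻¹.eval (RingHom.id K) c = f.denom.eval c / f.num.eval c := by
            field_simp at e ⊢
            rw [← e]
          rw [e2, map_div₀]
          exact div_le_one_of_le₀ h1 zero_le }
  comap_eq := by
    ext a
    have := limitFilter_neBot hA.1
    change (∀ᶠ c in A.limitFilter, O.valuation
      ((algebraMap K (RatFunc K) a).eval (RingHom.id K) c) ≤ 1) ↔ _
    rw [RatFunc.algebraMap_eq_C]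
    simp [ValuationSubring.valuation_le_one_iff]

theorem mem_limitExt_ring {hA : A.IsImmediate} {hD : A.FixesOrVanishes} {f : RatFunc K} :
    f ∈ (A.limitExt hA hD).ring ↔
      ∀ᶠ c in A.limitFilter, O.valuation (f.eval (RingHom.id K) c) ≤ 1 := Iff.rfl

theorem appr_limitExt (hA : A.IsImmediate) (hD : A.FixesOrVanishes) :
    (A.limitExt hA hD).appr = A := by
  symm
  refine ext_of_closed (funext fun r => ?_) fun r hr => hA.exists_lt hr
  ext c
  change _ ↔ (A.limitExt hA hD).val (RatFunc.X - RatFunc.C c) ≤ (A.limitExt hA hD).valueMap r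
  obtain ⟨d, rfl⟩ := O.valuation_surjective r
  rcases eq_or_ne d 0 with rfl | hd
  · refine iff_of_false (fun h => hA.zero_notMem_supp ⟨c, by rwa [map_zero] at h⟩) ?_
    rw [map_zero, map_zero, not_le]
    exact ValExt.val_X_sub_C_pos _ _
  have hd' : 0 < (A.limitExt hA hD).val (RatFunc.C d) :=
    zero_lt_iff.2 ((Valuation.ne_zero_iff _).2 (by simpa using hd))
  have hd0 : 0 < O.valuation d := zero_lt_iff.2 ((Valuation.ne_zero_iff _).2 hd)
  rw [← ValExt.val_C, ← div_le_one₀ hd', ← ValExt.val_div,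
    ValuationSubring.valuation_le_one_iff, mem_limitExt_ring]
  have e : (RatFunc.X - RatFunc.C c) / RatFunc.C d =
      algebraMap K[X] (RatFunc K) ((Polynomial.X - C c) * C d⁻¹) := by
    rw [map_mul, map_sub, RatFunc.algebraMap_X, RatFunc.algebraMap_C, RatFunc.algebraMap_C,
      map_inv₀, div_eq_mul_inv]
  have e2 : ∀ y, O.valuation (((RatFunc.X - RatFunc.C c) / RatFunc.C d).eval (RingHom.id K) y) ≤ 1 ↔
      O.valuation (y - c) ≤ O.valuation d := by
    intro y
    rw [e, RatFunc.eval_algebraMap]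
    simp only [Algebra.algebraMap_self, RingHom.id_apply, eval₂_id, eval_mul, eval_sub, eval_X,
      eval_C, map_mul, map_inv₀]
    rw [← div_eq_mul_inv, div_le_one₀ hd0]
  simp only [e2]
  constructor
  · intro h
    filter_upwards [eventually_mem_closed (A := A) ⟨c, h⟩] with y hy
    exact (mem_closed_iff h).1 hy
  · intro h
    -- A point y of a ball that misses c has distance more than the radius s from c. Hence s is
    -- below v₀ d, and the ball of radius v₀ d around y belongs to the nest and contains c.
    obtain ⟨s, hs, hcs⟩ := hA.exists_notMem_closed c
    have := limitFilter_neBot hA.1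
    obtain ⟨y, hy, hys⟩ := (h.and (eventually_mem_closed hs)).exists
    rw [mem_closed_iff hys, not_le] at hcs
    have hsd : s ≤ O.valuation d := by
      rw [Valuation.map_sub_swap] at hcs
      exact (hcs.trans_le hy).le
    rw [A.closed_of_closed s _ y hys hsd]
    change O.valuation (c - y) ≤ O.valuation d
    rwa [Valuation.map_sub_swap]

end ApproxType

/-! ### Eventually dominant terms -/

section Dominance

variable {α Γ : Type*} [LinearOrderedCommGroupWithZero Γ] {F : Filter α} {γ : α → Γ}

/-- After division by γ^i, the constant x is compared with y γ^(j - i), which eventually falls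
strictly below each value it takes: once it is ≤ x, it is eventually < x. -/
theorem eventually_monomial_lt_or_lt (h0 : ∀ a, γ a ≠ 0) (hγ : ∀ a, ∀ᶠ c in F, γ c < γ a)
    {x y : Γ} (hy : y ≠ 0) {i j : ℕ} (hij : i < j) :
    (∀ᶠ c in F, x * γ c ^ i < y * γ c ^ j) ∨ ∀ᶠ c in F, y * γ c ^ j < x * γ c ^ i := by
  have hpos : ∀ c n, 0 < γ c ^ n := fun c n => pow_pos (zero_lt_iff.2 (h0 c)) n
  have e : ∀ c, y * γ c ^ j = (y * γ c ^ (j - i)) * γ c ^ i := fun c => by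
    rw [mul_assoc, ← pow_add, Nat.sub_add_cancel hij.le]
  simp only [e, mul_lt_mul_iff_left₀ (hpos _ _)]
  by_cases h : ∃ a, y * γ a ^ (j - i) ≤ x
  · obtain ⟨a, ha⟩ := h
    right
    filter_upwards [hγ a] with c hc
    refine lt_of_lt_of_le (mul_lt_mul_of_pos_left ?_ (zero_lt_iff.2 hy)) ha
    exact pow_lt_pow_left₀ hc zero_le (by omega)
  · push Not at h
    exact Or.inl (Filter.Eventually.of_forall h)

/-- Each pair of terms is eventually strictly ordered, so a new term need only be compared with the
previous winner. -/
theorem exists_eventually_dominant (h0 : ∀ a, γ a ≠ 0) (hγ : ∀ a, ∀ᶠ c in F, γ c < γ a)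
    (B : ℕ → Γ) {s : Finset ℕ} (hs : s.Nonempty) (hB : ∀ i ∈ s, B i ≠ 0) :
    ∃ m ∈ s, ∀ᶠ c in F, ∀ i ∈ s, i ≠ m → B i * γ c ^ i < B m * γ c ^ m := by
  induction hs using Finset.Nonempty.cons_induction with
  | singleton a =>
    exact ⟨a, by simp, Filter.Eventually.of_forall fun c i hi hia =>
      absurd (Finset.mem_singleton.1 hi) hia⟩
  | cons a s ha hs ih =>
    obtain ⟨m, hm, h⟩ := ih fun i hi => hB i (Finset.mem_cons_of_mem hi)
    have hne : a ≠ m := fun e => ha (e ▸ hm)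
    have hB1 := hB a (Finset.mem_cons_self a s)
    have hB2 := hB m (Finset.mem_cons_of_mem hm)
    have hcmp : (∀ᶠ c in F, B a * γ c ^ a < B m * γ c ^ m) ∨
        ∀ᶠ c in F, B m * γ c ^ m < B a * γ c ^ a := by
      rcases lt_or_gt_of_ne hne with hlt | hlt
      · exact eventually_monomial_lt_or_lt h0 hγ hB2 hlt
      · exact (eventually_monomial_lt_or_lt h0 hγ hB1 hlt).symm
    rcases hcmp with h2 | h2
    · refine ⟨m, Finset.mem_cons_of_mem hm, ?_⟩
      filter_upwards [h, h2] with c h3 h4 i hi him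
      rcases Finset.mem_cons.1 hi with rfl | hi
      · exact h4
      · exact h3 i hi him
    · refine ⟨a, Finset.mem_cons_self a s, ?_⟩
      filter_upwards [h, h2] with c h3 h4 i hi hia
      rcases Finset.mem_cons.1 hi with rfl | hi
      · exact absurd rfl hia
      · by_cases him : i = m
        · rw [him]
          exact h4
        · exact (h3 i hi him).trans h4

end Dominance

/-! ### Kaplansky's approximation at transcendental immediate types -/

namespace ValExt

variable {K : Type*} [Field K] {O : ValuationSubring K} {v : ValExt O}

/-- No b is a best approximation to x: a ball missing b consists of points strictly closer to x. -/
theorem eventually_val_X_sub_C_lt (hA : v.appr.IsImmediate) (b : K) :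
    ∀ᶠ c in v.appr.limitFilter,
      v.val (RatFunc.X - RatFunc.C c) < v.val (RatFunc.X - RatFunc.C b) := by
  obtain ⟨s, hs, hb⟩ := hA.exists_notMem_closed b
  filter_upwards [ApproxType.eventually_mem_closed hs] with c hc
  have hb' : ¬ v.val (RatFunc.X - RatFunc.C b) ≤ v.valueMap s := hb
  exact lt_of_le_of_lt hc (not_le.1 hb')

/-- Taylor's formula without its constant term. The argument y is general so that both x and
constants can be inserted. -/
theorem aeval_sub_eval_eq_sum (y : RatFunc K) (f : K[X]) (c : K) :
    aeval y f - RatFunc.C (f.eval c) = ∑ i ∈ Finset.range f.natDegree,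
      RatFunc.C ((taylor c f).coeff (i + 1)) * (y - RatFunc.C c) ^ (i + 1) := by
  have h := congrArg (aeval y) (sum_taylor_eq f c)
  rw [Polynomial.sum_over_range _ (by simp), natDegree_taylor, map_sum,
    Finset.sum_range_succ'] at h
  simp only [map_mul, map_pow, map_sub, aeval_C, aeval_X, RatFunc.algebraMap_eq_C, pow_zero,
    mul_one, taylor_coeff_zero] at h
  rw [← h, add_sub_cancel_right]

/-- Kaplansky: at a transcendental immediate approximation type, `f(c)` approximates `f(x)`. -/
theorem eventually_val_sub_eval_lt (hA : v.appr.IsTranscendentalImmediate) {f : K[X]}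
    (hf : f ≠ 0) : ∀ᶠ c in v.appr.limitFilter,
      v.val (algebraMap K[X] (RatFunc K) f - RatFunc.C (f.eval c)) <
        v.val (RatFunc.C (f.eval c)) := by
  have hne := ApproxType.limitFilter_neBot hA.1.1
  -- The Taylor coefficients at c are the Hasse derivatives of f evaluated at c, so A fixes their
  -- values; the value is 0 only for an identically vanishing derivative.
  have hβ : ∀ i, ∃ β, (hasseDeriv i f = 0 → β = 0) ∧ (hasseDeriv i f ≠ 0 → β ≠ 0) ∧
      ∀ᶠ c in v.appr.limitFilter, O.valuation ((taylor c f).coeff i) = β := by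
    intro i
    simp only [taylor_coeff]
    by_cases hi : hasseDeriv i f = 0
    · exact ⟨0, fun _ => rfl, fun h => absurd hi h, Filter.Eventually.of_forall (by simp [hi])⟩
    · obtain ⟨β, h1, h2⟩ := hA.exists_value hi
      exact ⟨β, fun h => absurd h hi, fun _ => h1, h2⟩
  choose β hβ0 hβ1 hβ2 using hβ
  have hβall : ∀ᶠ c in v.appr.limitFilter, ∀ i ∈ Finset.range (f.natDegree + 1),
      O.valuation ((taylor c f).coeff i) = β i :=
    (Filter.eventually_all_finset _).2 fun i _ => hβ2 i
  have hf0 := hA.1.eventually_eval_ne_zero hf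
  have hpos : ∀ {c : K}, f.eval c ≠ 0 → 0 < v.val (RatFunc.C (f.eval c)) := fun hc =>
    zero_lt_iff.2 ((Valuation.ne_zero_iff _).2 (by simpa using hc))
  let s := (Finset.range (f.natDegree + 1)).filter fun i => i ≠ 0 ∧ β i ≠ 0
  by_cases hs : s.Nonempty
  · obtain ⟨m, hm, hdom⟩ := exists_eventually_dominant (F := v.appr.limitFilter)
      (γ := fun c => v.val (RatFunc.X - RatFunc.C c)) v.val_X_sub_C_ne_zero
      (eventually_val_X_sub_C_lt hA.1) (fun i => v.valueMap (β i)) hs (by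
        intro i hi h0
        rw [map_eq_zero] at h0
        exact (Finset.mem_filter.1 hi).2.2 h0)
    obtain ⟨hmn, hm0, hmβ⟩ := Finset.mem_filter.1 hm
    rw [Finset.mem_range] at hmn
    have hmβ' : v.valueMap (β m) ≠ 0 := by rwa [Ne, map_eq_zero]
    -- With m the dominant index, every y as far from c as x is gives v(f(y) - f(c)) = β_m v(x -
    -- c)^m.
    have key : ∀ᶠ c in v.appr.limitFilter, ∀ y : RatFunc K,
        v.val (y - RatFunc.C c) = v.val (RatFunc.X - RatFunc.C c) →
        v.val (aeval y f - RatFunc.C (f.eval c)) =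
          v.valueMap (β m) * v.val (RatFunc.X - RatFunc.C c) ^ m := by
      filter_upwards [hdom, hβall] with c h1 h2 y hy
      have hterm : ∀ i < f.natDegree,
          v.val (RatFunc.C ((taylor c f).coeff (i + 1)) * (y - RatFunc.C c) ^ (i + 1)) =
          v.valueMap (β (i + 1)) * v.val (RatFunc.X - RatFunc.C c) ^ (i + 1) := by
        intro i hi
        rw [val_mul, val_pow, hy, val_C, h2 (i + 1) (Finset.mem_range.2 (by omega))]
      obtain ⟨k, rfl⟩ := Nat.exists_eq_succ_of_ne_zero hm0
      rw [aeval_sub_eval_eq_sum]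
      refine (Valuation.map_sum_eq_of_lt (j := k) _ (Finset.mem_range.2 (by omega)) ?_).trans
        (hterm k (by omega))
      intro i hi
      rw [Finset.mem_sdiff, Finset.mem_range, Finset.mem_singleton] at hi
      refine lt_of_eq_of_lt (hterm i hi.1) (lt_of_lt_of_eq ?_ (hterm k (by omega)).symm)
      by_cases hβi : β (i + 1) = 0
      · rw [hβi, map_zero, zero_mul]
        exact mul_pos (zero_lt_iff.2 hmβ') (pow_pos (v.val_X_sub_C_pos c) _)
      · exact h1 (i + 1) (Finset.mem_filter.2 ⟨Finset.mem_range.2 (by omega), by omega, hβi⟩)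
          (by omega)
    have hβ0' : ∀ᶠ c in v.appr.limitFilter, v.val (RatFunc.C (f.eval c)) = v.valueMap (β 0) := by
      filter_upwards [hβ2 0] with c hc
      rw [taylor_coeff_zero] at hc
      rw [val_C, hc]
    obtain ⟨a, ha1, ha2⟩ := (key.and hβ0').exists
    -- Applied to y = c closer to x than a is: c is as far from a as x is, and f(c), f(a) both have
    -- value β 0, which bounds their difference. For points strictly closer to x than a, the bound
    -- becomes strict.
    have hle : v.valueMap (β m) * v.val (RatFunc.X - RatFunc.C a) ^ m ≤ v.valueMap (β 0) := by
      obtain ⟨c, hc1, hc2⟩ := (hβ0'.and (eventually_val_X_sub_C_lt hA.1 a)).exists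
      rw [← ha1 (RatFunc.C c), ← RatFunc.algebraMap_eq_C, aeval_algebraMap_apply,
        coe_aeval_eq_eval]
      · rw [RatFunc.algebraMap_eq_C]
        exact Valuation.map_sub_le _ hc1.le ha2.le
      · have e : RatFunc.C c - RatFunc.C a =
            (RatFunc.X - RatFunc.C a) - (RatFunc.X - RatFunc.C c) := by ring
        rw [e]
        exact Valuation.map_sub_eq_of_lt_left _ hc2
    filter_upwards [key, hβ0', eventually_val_X_sub_C_lt hA.1 a] with c h1 h2 h3
    rw [h2]
    refine lt_of_lt_of_le ?_ hle
    rw [← RatFunc.aeval_X_left_eq_algebraMap, h1 _ rfl]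
    exact mul_lt_mul_of_pos_left (pow_lt_pow_left₀ h3 zero_le hm0) (zero_lt_iff.2 hmβ')
  · have hzero : ∀ i, i < f.natDegree → β (i + 1) = 0 := by
      intro i hi
      by_contra h
      exact hs ⟨i + 1, Finset.mem_filter.2 ⟨Finset.mem_range.2 (by omega), by omega, h⟩⟩
    filter_upwards [hf0, hβall] with c h1 h2
    have e : algebraMap K[X] (RatFunc K) f - RatFunc.C (f.eval c) = 0 := by
      rw [← RatFunc.aeval_X_left_eq_algebraMap, aeval_sub_eval_eq_sum]
      refine Finset.sum_eq_zero fun i hi => ?_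
      rw [Finset.mem_range] at hi
      have h3 := h2 (i + 1) (Finset.mem_range.2 (by omega))
      rw [hzero i hi, Valuation.zero_iff] at h3
      rw [h3, map_zero, zero_mul]
    rw [e, val_zero]
    exact hpos h1

theorem isImmediate_of_appr (hA : v.appr.IsTranscendentalImmediate) : v.IsImmediate := by
  apply isImmediate_of_forall_exists
  intro f hf
  have := ApproxType.limitFilter_neBot hA.1.1
  obtain ⟨c, h1, h2⟩ := ((eventually_val_sub_eval_lt hA (RatFunc.num_ne_zero hf)).and
    (eventually_val_sub_eval_lt hA f.denom_ne_zero)).exists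
  refine ⟨f.num.eval c / f.denom.eval c, ?_⟩
  have h1' := h1.trans_eq (Valuation.map_eq_of_sub_lt _ h1).symm
  have h2' := h2.trans_eq (Valuation.map_eq_of_sub_lt _ h2).symm
  have h3 := v.ring.valuation.div_sub_div_lt h1' h2'
  rw [RatFunc.num_div_denom, ← map_div₀] at h3
  exact h3

/-! ### Completion types -/

/-- At a completion type, `f(c)` converges to `f(x)`. -/
theorem eventually_val_sub_eval_lt_valueMap (hA : v.appr.IsCompletionType) (f : K[X])
    {r : O.ValueGroup} (hr : r ≠ 0) : ∀ᶠ c in v.appr.limitFilter,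
      v.val (algebraMap K[X] (RatFunc K) f - RatFunc.C (f.eval c)) < v.valueMap r := by
  obtain ⟨c₀, M, hc₀, hM0, h1M, hcM, hM⟩ := hA.exists_bound
  obtain ⟨B, hB, hL⟩ := Polynomial.exists_lipschitz v.ring.valuation (M := M) f
  have hB' : 0 < O.valuation B := zero_lt_iff.2 ((Valuation.ne_zero_iff _).2 hB)
  obtain ⟨s, hs, hsr⟩ := hA.1.exists_lt (hA.mem_supp (r := r / O.valuation B)
    (div_ne_zero hr hB'.ne'))
  -- The element x lies in the same bounded set as the points c, so the Lipschitz bound in K(x)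
  -- applies to x and c.
  have hX : v.val RatFunc.X ≤ v.val (RatFunc.C M) := by
    have h1 : v.val (RatFunc.X - RatFunc.C c₀) ≤ v.valueMap 1 := hc₀
    rw [val_C]
    have h2 : v.val (RatFunc.C c₀) ≤ v.valueMap (O.valuation M) := by
      rw [val_C, valueMap_le_iff]
      exact hcM
    have := Valuation.map_add_le _ (h1.trans ((v.valueMap_le_iff _ _).2 h1M)) h2
    rwa [sub_add_cancel] at this
  filter_upwards [ApproxType.eventually_mem_closed hs, hM] with c hc hcM
  have hc' : v.val (RatFunc.X - RatFunc.C c) ≤ v.valueMap s := hc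
  have h1 := (hL RatFunc.X (RatFunc.C c) hX (by
    change v.val _ ≤ v.val (RatFunc.C M)
    rwa [val_C, val_C, valueMap_le_iff])).2
  rw [RatFunc.aeval_X_left_eq_algebraMap, ← RatFunc.algebraMap_eq_C, aeval_algebraMap_apply,
    coe_aeval_eq_eval, RatFunc.algebraMap_eq_C] at h1
  refine lt_of_le_of_lt (h1.trans (mul_le_mul_right hc' _)) ?_
  change v.val (RatFunc.C B) * _ < _
  rw [val_C, ← map_mul, valueMap_lt_iff]
  rwa [lt_div_iff₀ hB', mul_comm] at hsr

/-- As f(c) converges to f(x), either v f(x) dominates a nonzero element of v₀K, and f(c) eventually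
approximates f(x), or f(x) is smaller than all of v₀K, and then f(c) tends to 0. -/
theorem eventually_or_forall_lt (hA : v.appr.IsCompletionType) (f : K[X]) :
    (∀ᶠ c in v.appr.limitFilter,
      v.val (algebraMap K[X] (RatFunc K) f - RatFunc.C (f.eval c)) <
        v.val (RatFunc.C (f.eval c))) ∨
    ((∀ r, r ≠ 0 → v.val (algebraMap K[X] (RatFunc K) f) < v.valueMap r) ∧
      ∀ r, r ≠ 0 → ∀ᶠ c in v.appr.limitFilter, O.valuation (f.eval c) < r) := by
  by_cases h : ∃ r, r ≠ 0 ∧ v.valueMap r ≤ v.val (algebraMap K[X] (RatFunc K) f)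
  · left
    obtain ⟨r, hr, hrf⟩ := h
    filter_upwards [eventually_val_sub_eval_lt_valueMap hA f hr] with c hc
    have h1 := hc.trans_le hrf
    exact h1.trans_eq (val_eq_of_sub_lt h1).symm
  · right
    push Not at h
    refine ⟨h, fun r hr => ?_⟩
    filter_upwards [eventually_val_sub_eval_lt_valueMap hA f hr] with c hc
    rw [← valueMap_lt_iff v, ← val_C]
    have := Valuation.map_sub_lt _ (h r hr) hc
    rwa [sub_sub_cancel] at this

/-- An algebraic completion type gives a value-transcendental extension. -/
theorem isValueTranscendental_of_appr (hA : v.appr.IsAlgebraicCompletionType) :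
    v.IsValueTranscendental := by
  classical
  have hc := hA.1
  have hne := ApproxType.limitFilter_neBot hc.1.1
  have hex : ∃ p : K[X], p ≠ 0 ∧
      ∀ r, r ≠ 0 → v.val (algebraMap K[X] (RatFunc K) p) < v.valueMap r := by
    obtain ⟨p, hp⟩ := hA.2.2
    rw [ApproxType.fixesValue_iff hc.1.1] at hp
    have hp0 : p ≠ 0 := by
      rintro rfl
      exact hp ⟨0, Filter.Eventually.of_forall (by simp)⟩
    rcases hc.fixesOrVanishes p with ⟨β, -, h⟩ | h
    · exact absurd ⟨β, h⟩ hp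
    refine ⟨p, hp0, fun r hr => ?_⟩
    obtain ⟨c, h1, h2⟩ := ((h r hr).and (eventually_val_sub_eval_lt_valueMap hc p hr)).exists
    rw [← valueMap_lt_iff v, ← val_C] at h1
    have := Valuation.map_add_lt _ h2 h1
    rwa [sub_add_cancel] at this
  have hex' : ∃ n, ∃ p : K[X], p.natDegree = n ∧ p ≠ 0 ∧
      ∀ r, r ≠ 0 → v.val (algebraMap K[X] (RatFunc K) p) < v.valueMap r := by
    obtain ⟨p, hp⟩ := hex
    exact ⟨_, p, rfl, hp⟩
  -- Take p of least degree among the nonzero polynomials with p(x) smaller than all of v₀K;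
  -- polynomials of smaller degree are then approximated by nonzero constants.
  obtain ⟨p, hpn, hp0, hp⟩ := Nat.find_spec hex'
  have hmin : ∀ g : K[X], g ≠ 0 → g.degree < p.degree → ∃ a : K, a ≠ 0 ∧
      v.val (algebraMap K[X] (RatFunc K) g - RatFunc.C a) < v.val (RatFunc.C a) := by
    intro g hg hdeg
    rcases eventually_or_forall_lt hc g with h | h
    · obtain ⟨c, h1, h2⟩ := (h.and (hc.1.eventually_eval_ne_zero hg)).exists
      exact ⟨_, h2, h1⟩
    · exact absurd ⟨g, rfl, hg, h.1⟩
        (Nat.find_min hex' (hpn ▸ natDegree_lt_natDegree hg hdeg))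
  have hP0 : algebraMap K[X] (RatFunc K) p ≠ 0 := RatFunc.algebraMap_ne_zero hp0
  have hPpos : 0 < v.val (algebraMap K[X] (RatFunc K) p) :=
    zero_lt_iff.2 ((Valuation.ne_zero_iff _).2 hP0)
  have hpow : ∀ n : ℕ, n ≠ 0 → ∀ r, r ≠ 0 →
      v.val (algebraMap K[X] (RatFunc K) p) ^ n < v.valueMap r := by
    intro n hn r hr
    have h1 : v.val (algebraMap K[X] (RatFunc K) p) ≤ 1 := by
      rw [← map_one v.valueMap]
      exact (hp 1 one_ne_zero).le
    exact lt_of_le_of_lt (pow_le_of_le_one zero_le h1 hn) (hp r hr)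
  have ht : v.IsValueTranscendentalElt (algebraMap K[X] (RatFunc K) p) := by
    refine ⟨hP0, fun n hn => ?_⟩
    rintro ⟨r, hr⟩
    have hr0 : r ≠ 0 := by
      rintro rfl
      rw [map_zero, eq_comm] at hr
      exact (pow_pos hPpos n).ne' hr
    exact (hpow n hn r hr0).ne' hr
  refine v.isValueTranscendental_of_forall_exists ht (v.exists_approx_of_polynomial hP0 ?_)
  -- Induction on the degree through f = p q + r. If r ≠ 0, then r dominates: its value is in v₀K,
  -- while p q has the value of some a p^(k+1) and lies below v₀K. If r = 0, an approximation of q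
  -- is multiplied by p.
  have main : ∀ n : ℕ, ∀ f : K[X], f.natDegree = n → f ≠ 0 → ∃ a : K, ∃ k : ℕ,
      v.val (algebraMap K[X] (RatFunc K) f -
        RatFunc.C a * algebraMap K[X] (RatFunc K) p ^ k) < v.val (algebraMap K[X] (RatFunc K) f) := by
    intro n
    induction n using Nat.strong_induction_on with
    | _ n ih =>
    intro f hfn hf
    by_cases hdeg : f.degree < p.degree
    · obtain ⟨a, -, h1⟩ := hmin f hf hdeg
      refine ⟨a, 0, ?_⟩
      rw [pow_zero, mul_one]
      exact h1.trans_eq (Valuation.map_eq_of_sub_lt _ h1).symm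
    · have hdiv := EuclideanDomain.div_add_mod f p
      -- A nonzero constant has its value in v₀K; so p is not constant and the quotient has smaller
      -- degree than f.
      have hpdeg : p.natDegree ≠ 0 := by
        intro h
        obtain ⟨a, ha⟩ := natDegree_eq_zero.1 h
        have ha0 : a ≠ 0 := by
          rintro rfl
          rw [C_0] at ha
          exact hp0 ha.symm
        have h1 := hp (O.valuation a) ((Valuation.ne_zero_iff _).2 ha0)
        rw [← ha, RatFunc.algebraMap_C, val_C] at h1
        exact lt_irrefl _ h1
      have hq0 : f / p ≠ 0 := by
        rw [Ne, Polynomial.div_eq_zero_iff hp0]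
        exact hdeg
      have hqdeg : (f / p).natDegree < n := by
        rw [← hfn]
        exact natDegree_lt_natDegree hq0
          (degree_div_lt hf (natDegree_pos_iff_degree_pos.1 (Nat.pos_of_ne_zero hpdeg)))
      obtain ⟨a, k, hak⟩ := ih _ hqdeg (f / p) rfl hq0
      have e1 : algebraMap K[X] (RatFunc K) f = algebraMap K[X] (RatFunc K) p *
          algebraMap K[X] (RatFunc K) (f / p) + algebraMap K[X] (RatFunc K) (f % p) := by
        rw [← map_mul, ← map_add, hdiv]
      have hq : v.val (algebraMap K[X] (RatFunc K) (f / p)) =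
          v.val (RatFunc.C a * algebraMap K[X] (RatFunc K) p ^ k) :=
        (val_eq_of_sub_lt hak).symm
      have ha0 : a ≠ 0 := by
        rintro rfl
        rw [map_zero, zero_mul, val_zero, Valuation.zero_iff] at hq
        exact RatFunc.algebraMap_ne_zero hq0 hq
      have hPq : v.val (algebraMap K[X] (RatFunc K) p * algebraMap K[X] (RatFunc K) (f / p)) =
          v.val (RatFunc.C a) * v.val (algebraMap K[X] (RatFunc K) p) ^ (k + 1) := by
        rw [val_mul, hq, val_mul, val_pow, pow_succ', mul_left_comm]
      have hPqa : v.val (algebraMap K[X] (RatFunc K) p * algebraMap K[X] (RatFunc K) (f / p) -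
          RatFunc.C a * algebraMap K[X] (RatFunc K) p ^ (k + 1)) <
          v.val (algebraMap K[X] (RatFunc K) p * algebraMap K[X] (RatFunc K) (f / p)) := by
        have e2 : algebraMap K[X] (RatFunc K) p * algebraMap K[X] (RatFunc K) (f / p) -
            RatFunc.C a * algebraMap K[X] (RatFunc K) p ^ (k + 1) =
            algebraMap K[X] (RatFunc K) p * (algebraMap K[X] (RatFunc K) (f / p) -
              RatFunc.C a * algebraMap K[X] (RatFunc K) p ^ k) := by ring
        rw [e2, val_mul, val_mul]
        exact mul_lt_mul_of_pos_left hak hPpos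
      by_cases hr0 : f % p = 0
      · refine ⟨a, k + 1, ?_⟩
        rw [e1, hr0, map_zero, add_zero]
        exact hPqa
      · obtain ⟨b, hb0, hb⟩ := hmin (f % p) hr0 (Polynomial.degree_mod_lt f hp0)
        have hvb := Valuation.map_eq_of_sub_lt _ hb
        have hva : O.valuation a ≠ 0 := (Valuation.ne_zero_iff _).2 ha0
        have hlt : v.val (algebraMap K[X] (RatFunc K) p *
            algebraMap K[X] (RatFunc K) (f / p)) < v.val (RatFunc.C b) := by
          have h1 := hpow (k + 1) (by omega) (O.valuation b / O.valuation a)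
            (div_ne_zero ((Valuation.ne_zero_iff _).2 hb0) hva)
          rw [map_div₀, ← val_C, ← val_C, lt_div_iff₀, mul_comm] at h1
          · rwa [hPq]
          · exact zero_lt_iff.2 ((Valuation.ne_zero_iff _).2 (by simpa using ha0))
        refine ⟨b, 0, ?_⟩
        have hval : v.val (algebraMap K[X] (RatFunc K) f) = v.val (RatFunc.C b) := by
          rw [e1]
          exact (Valuation.map_add_eq_of_lt_right _ (hlt.trans_eq hvb.symm)).trans hvb
        rw [pow_zero, mul_one, hval, e1, add_sub_assoc]
        exact Valuation.map_add_lt _ hlt hb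
  intro f hf
  obtain ⟨a, k, h⟩ := main _ f rfl hf
  exact ⟨a, k, by rwa [zpow_natCast]⟩

/-! ### Uniqueness for immediate approximation types -/

/-- Either `f(c)` approximates `f(x)`, or `f(c)` and `f(x)` are smaller than the value group. -/
def ApproximatesOrVanishes (v : ValExt O) : Prop :=
  ∀ f : K[X], (∀ᶠ c in v.appr.limitFilter,
      v.val (algebraMap K[X] (RatFunc K) f - RatFunc.C (f.eval c)) <
        v.val (RatFunc.C (f.eval c))) ∨
    ((∀ r, r ≠ 0 → v.val (algebraMap K[X] (RatFunc K) f) < v.valueMap r) ∧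
      ∀ r, r ≠ 0 → ∀ᶠ c in v.appr.limitFilter, O.valuation (f.eval c) < r)

theorem approximatesOrVanishes_of_isTranscendentalImmediate
    (hA : v.appr.IsTranscendentalImmediate) : v.ApproximatesOrVanishes := by
  intro f
  by_cases hf : f = 0
  · right
    constructor
    · intro r hr
      rw [hf, map_zero, val_zero, ← map_zero v.valueMap, valueMap_lt_iff]
      exact zero_lt_iff.2 hr
    · intro r hr
      exact Filter.Eventually.of_forall fun c => by simpa [hf] using zero_lt_iff.2 hr
  · exact Or.inl (eventually_val_sub_eval_lt hA hf)

/-- Values of numerator and denominator are read off at points near the nest, and by coprimality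
they do not both vanish in the limit. The resulting criterion involves v only through its
approximation type, which gives uniqueness. -/
theorem ApproximatesOrVanishes.mem_ring_iff (h : v.ApproximatesOrVanishes)
    (hA : v.appr.IsImmediate) (hD : v.appr.FixesOrVanishes) (f : RatFunc K) :
    f ∈ v.ring ↔ ∀ᶠ c in v.appr.limitFilter,
      O.valuation (f.num.eval c) ≤ O.valuation (f.denom.eval c) := by
  have hne := ApproxType.limitFilter_neBot hA.1
  have hval : ∀ {g : K[X]} {c : K}, v.val (algebraMap K[X] (RatFunc K) g - RatFunc.C (g.eval c)) <
      v.val (RatFunc.C (g.eval c)) →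
      v.val (algebraMap K[X] (RatFunc K) g) = v.valueMap (O.valuation (g.eval c)) :=
    fun h => (Valuation.map_eq_of_sub_lt _ h).trans (v.val_C _)
  have hpos : ∀ {r s : v.ring.ValueGroup}, r < s → s ≠ 0 := fun h => (lt_of_le_of_lt zero_le h).ne'
  have hmem : f ∈ v.ring ↔ v.val (algebraMap K[X] (RatFunc K) f.num) ≤
      v.val (algebraMap K[X] (RatFunc K) f.denom) := by
    rw [← ValuationSubring.valuation_le_one_iff]
    conv_lhs => rw [← RatFunc.num_div_denom f, map_div₀]
    rw [div_le_one₀]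
    exact zero_lt_iff.2 ((Valuation.ne_zero_iff _).2
      (RatFunc.algebraMap_ne_zero f.denom_ne_zero))
  rw [hmem]
  rcases h f.num with hn | ⟨hn, hn'⟩ <;> rcases h f.denom with hd | ⟨hd, hd'⟩
  · constructor
    · intro hle
      filter_upwards [hn, hd] with c h1 h2
      rwa [hval h1, hval h2, valueMap_le_iff] at hle
    · intro hle
      obtain ⟨c, h1, h2, h3⟩ := (hle.and (hn.and hd)).exists
      rwa [hval h2, hval h3, valueMap_le_iff]
  · obtain ⟨c, h1⟩ := hn.exists
    have hr : O.valuation (f.num.eval c) ≠ 0 := by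
      have := hpos h1
      rwa [val_C, Ne, map_eq_zero] at this
    refine iff_of_false ?_ ?_
    · rw [hval h1, not_le]
      exact hd _ hr
    · intro hle
      obtain ⟨c', h2, h3, h4⟩ := (hle.and (hn.and (hd' _ hr))).exists
      have := hval h3
      rw [hval h1] at this
      rw [v.valueMap_injective this] at h4
      exact absurd h2 (not_le.2 h4)
  · obtain ⟨c, h1⟩ := hd.exists
    have hr : O.valuation (f.denom.eval c) ≠ 0 := by
      have := hpos h1
      rwa [val_C, Ne, map_eq_zero] at this
    refine iff_of_true ?_ ?_
    · rw [hval h1]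
      exact (hn _ hr).le
    · filter_upwards [hd, hn' _ hr] with c' h3 h4
      have := hval h3
      rw [hval h1] at this
      rw [v.valueMap_injective this] at h4
      exact h4.le
  · exact (hD.not_vanishes_of_isCoprime hA.1 f.isCoprime_num_denom hn' hd').elim

theorem ApproximatesOrVanishes.eq_of_appr_eq {w : ValExt O} (hv : v.ApproximatesOrVanishes)
    (hw : w.ApproximatesOrVanishes) (hA : v.appr.IsImmediate) (hD : v.appr.FixesOrVanishes)
    (h : w.appr = v.appr) : w = v := by
  ext f
  rw [hv.mem_ring_iff hA hD, hw.mem_ring_iff (h ▸ hA) (h ▸ hD), h]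

end ValExt

/-! ### Kinds of approximation types and the four cases of almost purity -/

namespace ApproxType

variable {K : Type*} [Field K] {O : ValuationSubring K} {A : ApproxType O}

theorem IsValueExtending.not_isResidueExtending (hA : A.IsValueExtending) :
    ¬ A.IsResidueExtending := by
  rintro ⟨-, h, c, hc⟩
  obtain ⟨r, hr, -, hcr⟩ := h c
  exact hcr (hc.2 r (hA.2.1 r hr))

theorem IsImmediate.not_isValueExtending (hA : A.IsImmediate) : ¬ A.IsValueExtending := by
  rintro ⟨-, -, c, hc⟩
  rw [hA.2] at hc
  exact hc

theorem IsImmediate.not_isResidueExtending (hA : A.IsImmediate) : ¬ A.IsResidueExtending := by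
  rintro ⟨-, -, c, hc⟩
  rw [hA.2] at hc
  exact hc

theorem IsTranscendentalImmediate.not_isAlgebraicImmediate (hA : A.IsTranscendentalImmediate) :
    ¬ A.IsAlgebraicImmediate := by
  rintro ⟨-, f, hf⟩
  exact hf (hA.2 f)

end ApproxType

namespace ValExt

variable {K : Type*} [Field K] {O : ValuationSubring K} {v : ValExt O}

theorem not_isTrivial_appr (v : ValExt O) : ¬ v.appr.IsTrivial := by
  rintro ⟨c, hc⟩
  have hc' : v.val (RatFunc.X - RatFunc.C c) ≤ v.valueMap 0 := hc
  rw [map_zero] at hc'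
  exact absurd (v.val_X_sub_C_pos c) (not_lt.2 hc')

namespace IsGaussAt

variable {b : K} (h : v.IsGaussAt b)
include h

/-- The Taylor term of degree 1 of X - c at b is x - b itself. So b is a best approximation to x,
and lies in all balls. -/
theorem val_X_sub_C_le (c : K) :
    v.val (RatFunc.X - RatFunc.C b) ≤ v.val (RatFunc.X - RatFunc.C c) := by
  have h1 := h (Polynomial.X - C c) 1
  simpa [taylorTerm, coeff_C] using h1

theorem mem_inter_appr : b ∈ v.appr.inter := by
  refine ⟨fun r ⟨c, hc⟩ => ?_, fun r ⟨c, hc⟩ => ?_⟩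
  · have hc' : v.val (RatFunc.X - RatFunc.C c) ≤ v.valueMap r := hc
    exact (h.val_X_sub_C_le c).trans hc'
  · have hc' : v.val (RatFunc.X - RatFunc.C c) < v.valueMap r := hc
    exact (h.val_X_sub_C_le c).trans_lt hc'

end IsGaussAt

theorem IsValueTranscendentalElt.isValueExtending_appr {b : K}
    (h : v.IsValueTranscendentalElt (RatFunc.X - RatFunc.C b)) : v.appr.IsValueExtending := by
  refine ⟨v.not_isTrivial_appr, fun r hr => ⟨b, ?_⟩, b, h.isGaussAt.mem_inter_appr⟩
  have h1 : v.val (RatFunc.X - RatFunc.C b) ≤ v.valueMap r := h.isGaussAt.mem_inter_appr.1 r hr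
  refine lt_of_le_of_ne h1 fun e => h.2 1 one_ne_zero ⟨r, ?_⟩
  rw [pow_one, e]

/-- Since v has no new values, v(x - c) is itself a radius in v₀K; at this radius c lies in the
closed ball but not in the open one. -/
theorem IsResidueTranscendentalElt.isResidueExtending_appr {b d : K}
    (h : v.IsResidueTranscendentalElt (RatFunc.C d * (RatFunc.X - RatFunc.C b))) :
    v.appr.IsResidueExtending := by
  refine ⟨v.not_isTrivial_appr, fun c => ?_, b, h.isGaussAt.mem_inter_appr⟩
  obtain ⟨r, hr⟩ := h.valueMap_surjective (v.val (RatFunc.X - RatFunc.C c))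
  exact ⟨r, ⟨c, hr.ge⟩, hr.ge, fun hlt => absurd hr.symm (ne_of_lt hlt)⟩

/-- If v(x - b) were a radius r, the closed ball of radius r would be in the nest, hence also the
open one, and it would contain b. -/
theorem val_X_sub_C_notMem_range (hA : v.appr.IsValueExtending) {b : K} (hb : b ∈ v.appr.inter) :
    v.val (RatFunc.X - RatFunc.C b) ∉ Set.range v.valueMap := by
  rintro ⟨r, hr⟩
  exact absurd hr.symm (ne_of_lt (hb.2 r (hA.2.1 r ⟨b, hr.ge⟩)))

theorem IsAlmostPure.cases (h : v.IsAlmostPure) :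
    (∃ b, v.IsValueTranscendentalElt (RatFunc.X - RatFunc.C b)) ∨
    (∃ b d, v.IsResidueTranscendentalElt (RatFunc.C d * (RatFunc.X - RatFunc.C b))) ∨
    v.appr.IsTranscendentalImmediate ∨ v.appr.IsAlgebraicCompletionType := by
  rcases h with (⟨b, d, h | h⟩ | h) | h
  · exact Or.inl ⟨b, h.of_C_mul⟩
  · exact Or.inr (Or.inl ⟨b, d, h⟩)
  · exact Or.inr (Or.inr (Or.inl h))
  · exact Or.inr (Or.inr (Or.inr h))

theorem isAlmostPure_of_isValueTranscendentalElt {b : K}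
    (h : v.IsValueTranscendentalElt (RatFunc.X - RatFunc.C b)) : v.IsAlmostPure :=
  Or.inl (Or.inl ⟨b, 1, Or.inl (by rwa [map_one, one_mul])⟩)

theorem isAlmostPure_of_isResidueTranscendentalElt {b d : K}
    (h : v.IsResidueTranscendentalElt (RatFunc.C d * (RatFunc.X - RatFunc.C b))) :
    v.IsAlmostPure :=
  Or.inl (Or.inl ⟨b, d, Or.inr h⟩)

theorem IsAlmostPure.exists_isValueTranscendentalElt_iff (h : v.IsAlmostPure) :
    (∃ b, v.IsValueTranscendentalElt (RatFunc.X - RatFunc.C b)) ↔ v.appr.IsValueExtending := by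
  refine ⟨fun ⟨b, hb⟩ => hb.isValueExtending_appr, fun hA => ?_⟩
  rcases h.cases with h | ⟨b, d, h⟩ | h | h
  · exact h
  · exact absurd h.isResidueExtending_appr hA.not_isResidueExtending
  · exact absurd hA h.1.not_isValueExtending
  · exact absurd hA h.1.1.not_isValueExtending

theorem IsAlmostPure.exists_isResidueTranscendentalElt_iff (h : v.IsAlmostPure) :
    (∃ b d, v.IsResidueTranscendentalElt (RatFunc.C d * (RatFunc.X - RatFunc.C b))) ↔
      v.appr.IsResidueExtending := by
  refine ⟨fun ⟨b, d, hb⟩ => hb.isResidueExtending_appr, fun hA => ?_⟩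
  rcases h.cases with ⟨b, h⟩ | h | h | h
  · exact absurd hA h.isValueExtending_appr.not_isResidueExtending
  · exact h
  · exact absurd hA h.1.not_isResidueExtending
  · exact absurd hA h.1.1.not_isResidueExtending

theorem IsAlmostPure.isAlmostPure_appr (h : v.IsAlmostPure) : v.appr.IsAlmostPure := by
  rcases h.cases with ⟨b, h⟩ | ⟨b, d, h⟩ | h | h
  · exact Or.inl (Or.inr (Or.inl h.isValueExtending_appr))
  · exact Or.inl (Or.inr (Or.inr h.isResidueExtending_appr))
  · exact Or.inl (Or.inl h)
  · exact Or.inr h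

/-! ### Uniqueness -/

/-- A power of v t in v₀K has a root in v₀K, which is v t because roots in ordered groups are
unique. -/
theorem isValueTranscendentalElt_of_isDivisible (hO : O.IsDivisible) {t : RatFunc K} (ht : t ≠ 0)
    (h : v.val t ∉ Set.range v.valueMap) : v.IsValueTranscendentalElt t := by
  refine ⟨ht, fun n hn => ?_⟩
  rintro ⟨r, hr⟩
  have hr0 : r ≠ 0 := by
    rintro rfl
    rw [map_zero, eq_comm] at hr
    exact pow_ne_zero n ((Valuation.ne_zero_iff _).2 ht) hr
  obtain ⟨s, hs⟩ := hO n hn (Units.mk0 r hr0)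
  have hs' : (s : O.ValueGroup) ^ n = r := congrArg Units.val hs
  rw [← hs', map_pow] at hr
  exact h ⟨s, (pow_left_inj₀ zero_le zero_le hn).1 hr⟩

/-- Both extensions are Gauss valuations at a common b. Comparing a(x - b)^i with c(x - b)^j for i ≠
j amounts to comparing v(x - b) with a root s of a value of K, that is, to whether b lies in the
ball of radius s. -/
theorem eq_of_isValueExtending (hO : O.IsDivisible) (hA : v.appr.IsValueExtending) {w : ValExt O}
    (h : w.appr = v.appr) : w = v := by
  obtain ⟨b, hb⟩ := hA.2.2
  have key : ∀ {v : ValExt O}, v.appr.IsValueExtending → b ∈ v.appr.inter →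
      v.IsValueTranscendentalElt (RatFunc.X - RatFunc.C b) := fun hA hb =>
    isValueTranscendentalElt_of_isDivisible hO (X_sub_C_ne_zero b) (val_X_sub_C_notMem_range hA hb)
  have hroot : ∀ n : ℕ, n ≠ 0 → ∀ a : K, a ≠ 0 → ∃ s : O.ValueGroup, s ^ n = O.valuation a := by
    intro n hn a ha
    obtain ⟨s, hs⟩ := hO n hn (Units.mk0 (O.valuation a) ((Valuation.ne_zero_iff _).2 ha))
    exact ⟨s, congrArg Units.val hs⟩
  refine (key (h ▸ hA) (h ▸ hb)).isGaussAt.eq_of_val_le_iff (key hA hb).isGaussAt ?_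
  intro a c i j
  by_cases ha : a = 0
  · simp [ha]
  by_cases hc : c = 0
  · have : ∀ u : ValExt O, ¬ u.val (RatFunc.C a * (RatFunc.X - RatFunc.C b) ^ i) ≤
        u.val (RatFunc.C c * (RatFunc.X - RatFunc.C b) ^ j) := by
      intro u
      rw [hc, map_zero, zero_mul, val_zero, not_le]
      exact zero_lt_iff.2 ((Valuation.ne_zero_iff _).2
        (mul_ne_zero (by simpa using ha) (pow_ne_zero i (X_sub_C_ne_zero b))))
    exact iff_of_false (this w) (this v)
  have hpos : ∀ (u : ValExt O) (n : ℕ), 0 < u.val (RatFunc.X - RatFunc.C b) ^ n := fun u n =>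
    pow_pos (u.val_X_sub_C_pos b) n
  have hposC : ∀ (u : ValExt O) {e : K}, e ≠ 0 → 0 < u.val (RatFunc.C e) := fun u e he =>
    zero_lt_iff.2 ((Valuation.ne_zero_iff _).2 (by simpa using he))
  simp only [val_mul, val_pow]
  rcases lt_trichotomy i j with hij | hij | hij
  · obtain ⟨n, rfl⟩ := Nat.exists_eq_add_of_lt hij
    obtain ⟨s, hs⟩ := hroot (n + 1) (by omega) (a / c) (div_ne_zero ha hc)
    have e : ∀ u : ValExt O, (u.val (RatFunc.C a) * u.val (RatFunc.X - RatFunc.C b) ^ i ≤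
        u.val (RatFunc.C c) * u.val (RatFunc.X - RatFunc.C b) ^ (i + n + 1)) ↔
        b ∉ u.appr.opn s := by
      intro u
      change _ ↔ ¬ u.val (RatFunc.X - RatFunc.C b) < u.valueMap s
      rw [not_lt, ← pow_le_pow_iff_left₀ (a := u.valueMap s) zero_le zero_le n.succ_ne_zero, Nat.succ_eq_add_one,
        ← map_pow u.valueMap, hs, ← val_C, map_div₀, val_div, div_le_iff₀ (hposC u hc), add_assoc, add_comm i,
        pow_add, ← mul_assoc, mul_le_mul_iff_left₀ (hpos u i), mul_comm]
    rw [e, e, h]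
  · subst hij
    rw [mul_le_mul_iff_left₀ (hpos w i), mul_le_mul_iff_left₀ (hpos v i), val_C, val_C, val_C,
      val_C, valueMap_le_iff, valueMap_le_iff]
  · obtain ⟨n, rfl⟩ := Nat.exists_eq_add_of_lt hij
    obtain ⟨s, hs⟩ := hroot (n + 1) (by omega) (c / a) (div_ne_zero hc ha)
    have e : ∀ u : ValExt O, (u.val (RatFunc.C a) *
        u.val (RatFunc.X - RatFunc.C b) ^ (j + n + 1) ≤
        u.val (RatFunc.C c) * u.val (RatFunc.X - RatFunc.C b) ^ j) ↔ b ∈ u.appr.closed s := by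
      intro u
      change _ ↔ u.val (RatFunc.X - RatFunc.C b) ≤ u.valueMap s
      rw [← pow_le_pow_iff_left₀ (b := u.valueMap s) zero_le zero_le n.succ_ne_zero, Nat.succ_eq_add_one,
        ← map_pow u.valueMap, hs, ← val_C, map_div₀, val_div, le_div_iff₀ (hposC u ha), add_assoc, add_comm j,
        pow_add, ← mul_assoc, mul_le_mul_iff_left₀ (hpos u j), mul_comm]
    rw [e, e, h]

/-- The centre of a residue-transcendental element can be moved. -/
theorem IsResidueTranscendentalElt.of_val_le {b c d : K}
    (h : v.IsResidueTranscendentalElt (RatFunc.C d * (RatFunc.X - RatFunc.C b)))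
    (hc : v.val (RatFunc.X - RatFunc.C c) ≤ v.val (RatFunc.X - RatFunc.C b)) :
    v.IsResidueTranscendentalElt (RatFunc.C d * (RatFunc.X - RatFunc.C c)) := by
  have hle : v.val (RatFunc.C d * (RatFunc.X - RatFunc.C c)) ≤ 1 := by
    rw [← h.1, val_mul, val_mul]
    exact mul_le_mul_right hc _
  have hmem : RatFunc.C d * (RatFunc.X - RatFunc.C c) ∈ v.ring :=
    v.ring.mem_of_valuation_le_one _ hle
  have heq : RatFunc.C d * (RatFunc.X - RatFunc.C c) =
      RatFunc.C d * (RatFunc.X - RatFunc.C b) + algebraMap K (RatFunc K) (d * (b - c)) := by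
    rw [RatFunc.algebraMap_eq_C, map_mul, map_sub]
    ring
  have he : d * (b - c) ∈ O := by
    rw [← v.mem_iff]
    have := v.ring.sub_mem hmem h.2.1
    rwa [heq, add_sub_cancel_left] at this
  -- Moving the centre translates the residue by an element of Kv₀, so it stays transcendental. In
  -- particular it is nonzero, which gives the value 1.
  have htr : Transcendental (IsLocalRing.ResidueField O)
      (IsLocalRing.residue v.ring ⟨_, hmem⟩) := by
    have e : IsLocalRing.residue v.ring ⟨_, hmem⟩ = IsLocalRing.residue v.ring ⟨_, h.2.1⟩ +
        algebraMap (IsLocalRing.ResidueField O) (IsLocalRing.ResidueField v.ring)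
          (IsLocalRing.residue O ⟨_, he⟩) := by
      change _ = _ + IsLocalRing.residue v.ring (v.ringMap ⟨_, he⟩)
      rw [← map_add]
      congr 1
      exact Subtype.ext heq
    rw [transcendental_iff]
    intro p hp
    have h2 := transcendental_iff.1 h.2.2 (p.comp (Polynomial.X + C (IsLocalRing.residue O ⟨_, he⟩)))
      (by rwa [aeval_comp, map_add, aeval_X, aeval_C, ← e])
    rw [← taylor_apply] at h2
    exact taylor_injective (IsLocalRing.residue O ⟨_, he⟩) (by simpa using h2)
  refine ⟨?_, hmem, htr⟩
  rcases v.ring.valuation_lt_one_or_eq_one ⟨_, hmem⟩ with h1 | h1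
  · rw [← ValuationSubring.valuation_lt_one_iff, ← IsLocalRing.residue_eq_zero_iff] at h1
    rw [h1] at htr
    exact absurd htr (by
      rw [Transcendental, not_not]
      exact isAlgebraic_zero)
  · exact h1

/-- The type forces w to have a residue-transcendental element as well. Since b is a best
approximation to x also for w, its centre can be moved to b; then v and w give x - b the same value
in v₀K, and all monomials compare alike. -/
theorem IsResidueTranscendentalElt.eq_of_appr_eq {b d : K}
    (h : v.IsResidueTranscendentalElt (RatFunc.C d * (RatFunc.X - RatFunc.C b))) {w : ValExt O}
    (hw : w.IsAlmostPure) (hwv : w.appr = v.appr) : w = v := by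
  have hres : w.appr.IsResidueExtending := hwv ▸ h.isResidueExtending_appr
  obtain ⟨c, e, hc⟩ := hw.exists_isResidueTranscendentalElt_iff.2 hres
  have hmem : ∀ {a : K} {r : O.ValueGroup}, w.val (RatFunc.X - RatFunc.C a) ≤ w.valueMap r ↔
      v.val (RatFunc.X - RatFunc.C a) ≤ v.valueMap r := by
    intro a r
    change a ∈ w.appr.closed r ↔ a ∈ v.appr.closed r
    rw [hwv]
  have hwb : w.val (RatFunc.X - RatFunc.C b) ≤ w.val (RatFunc.X - RatFunc.C c) := by
    obtain ⟨r, hr⟩ := hc.valueMap_surjective (w.val (RatFunc.X - RatFunc.C c))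
    rw [← hr]
    have h1 : v.val (RatFunc.X - RatFunc.C c) ≤ v.valueMap r := hmem.1 hr.ge
    exact hmem.2 ((h.isGaussAt.val_X_sub_C_le c).trans h1)
  have hwt := hc.of_val_le hwb
  obtain ⟨r, hr⟩ := h.valueMap_surjective (v.val (RatFunc.X - RatFunc.C b))
  obtain ⟨s, hs⟩ := hwt.valueMap_surjective (w.val (RatFunc.X - RatFunc.C b))
  have hrs : r = s := by
    apply le_antisymm
    · rw [← valueMap_le_iff v, hr]
      exact hmem.1 hs.ge
    · rw [← valueMap_le_iff w, hs]
      exact hmem.2 hr.ge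
  subst hrs
  refine hwt.isGaussAt.eq_of_val_le_iff h.isGaussAt fun a a' i j => ?_
  simp only [val_mul, val_pow, val_C, ← hr, ← hs, ← map_pow, ← map_mul, valueMap_le_iff]

/-! ### Existence -/

section Existence

variable {Γ : Type*} [LinearOrderedCommGroupWithZero Γ] {e : O.ValueGroup →*₀ Γ}
  (he : StrictMono e) {φ : Γ} (hφ : φ ≠ 0)

/-- The Gauss extension of the valuation of `O` with `x - c ↦ φ`. -/
def gaussExt (c : K) : ValExt O :=
  ofValuation ((O.valuation.map e he.monotone).gaussRatFunc hφ c) fun a => by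
    rw [Valuation.gaussRatFunc_C, Valuation.map_apply, ← map_one e, he.le_iff_le,
      ValuationSubring.valuation_le_one_iff]

theorem gaussExt_val_le_iff (c : K) (f g : RatFunc K) :
    (gaussExt he hφ c).val f ≤ (gaussExt he hφ c).val g ↔
      (O.valuation.map e he.monotone).gaussRatFunc hφ c f ≤
        (O.valuation.map e he.monotone).gaussRatFunc hφ c g :=
  ofValuation_val_le_iff _ _ f g

theorem gaussExt_val_X_sub_C_le_iff (c a : K) (r : O.ValueGroup) :
    (gaussExt he hφ c).val (RatFunc.X - RatFunc.C a) ≤ (gaussExt he hφ c).valueMap r ↔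
      φ ≤ e r ∧ O.valuation (a - c) ≤ r := by
  obtain ⟨d, rfl⟩ := O.valuation_surjective r
  rw [← val_C, gaussExt_val_le_iff, Valuation.gaussRatFunc_X_sub_C, Valuation.gaussRatFunc_C,
    max_le_iff, Valuation.map_apply, Valuation.map_apply, he.le_iff_le, Valuation.map_sub_swap]

theorem gaussExt_val_X_sub_C_lt_iff (c a : K) (r : O.ValueGroup) :
    (gaussExt he hφ c).val (RatFunc.X - RatFunc.C a) < (gaussExt he hφ c).valueMap r ↔
      φ < e r ∧ O.valuation (a - c) < r := by
  obtain ⟨d, rfl⟩ := O.valuation_surjective r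
  rw [← val_C, ← not_le, gaussExt_val_le_iff, not_le, Valuation.gaussRatFunc_X_sub_C,
    Valuation.gaussRatFunc_C, max_lt_iff, Valuation.map_apply, Valuation.map_apply, he.lt_iff_lt,
    Valuation.map_sub_swap]

/-- The Gauss value of x - a is max(φ, v₀(a - c)), so a ball condition splits into one on the
radius, matched with the nest by `h1` and `h2`, and one on the distance from the centre c. -/
theorem appr_gaussExt {A : ApproxType O} {c : K} (h1 : ∀ r, φ ≤ e r ↔ c ∈ A.closed r)
    (h2 : ∀ r, φ < e r ↔ c ∈ A.opn r) (hc : c ∈ A.inter) : (gaussExt he hφ c).appr = A := by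
  ext r a
  · change (gaussExt he hφ c).val (RatFunc.X - RatFunc.C a) ≤ (gaussExt he hφ c).valueMap r ↔ _
    rw [gaussExt_val_X_sub_C_le_iff, h1]
    refine ⟨fun ⟨h, h'⟩ => (ApproxType.mem_closed_iff h).2 h', fun h => ?_⟩
    have hcr := hc.1 r ⟨a, h⟩
    exact ⟨hcr, (ApproxType.mem_closed_iff hcr).1 h⟩
  · change (gaussExt he hφ c).val (RatFunc.X - RatFunc.C a) < (gaussExt he hφ c).valueMap r ↔ _
    rw [gaussExt_val_X_sub_C_lt_iff, h2]
    constructor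
    · rintro ⟨h, h'⟩
      rw [A.opn_of_opn r r c h le_rfl]
      exact h'
    · intro h
      have hcr := hc.2 r ⟨a, h⟩
      refine ⟨hcr, ?_⟩
      rw [A.opn_of_opn r r c hcr le_rfl] at h
      exact h

end Existence

/-- A relation for the residue lifts to an integral Q such that Q(d(x - c)) has Gauss value below 1.
Because v₀(d) r = 1, each coefficient of Q has value below 1, so the relation is trivial. -/
theorem isResidueTranscendentalElt_gaussExt {r : O.ValueGroup} (hr : r ≠ 0) (c : K) {d : K}
    (hd : O.valuation d * r = 1) :
    (gaussExt (e := MonoidWithZeroHom.id O.ValueGroup) strictMono_id hr c).IsResidueTranscendentalElt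
      (RatFunc.C d * (RatFunc.X - RatFunc.C c)) := by
  set v := gaussExt (e := MonoidWithZeroHom.id O.ValueGroup) strictMono_id hr c with hv
  set w := (O.valuation.map (MonoidWithZeroHom.id O.ValueGroup)
    strictMono_id.monotone).gaussRatFunc hr c with hw
  have hle : ∀ f g, v.val f ≤ v.val g ↔ w f ≤ w g := gaussExt_val_le_iff _ hr c
  have hd0 : d ≠ 0 := by
    rintro rfl
    simp at hd
  have hwt : w (RatFunc.C d * (RatFunc.X - RatFunc.C c)) = w 1 := by
    rw [map_one, map_mul, hw, Valuation.gaussRatFunc_X_sub_C, Valuation.gaussRatFunc_C, sub_self,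
      map_zero, max_eq_left zero_le]
    exact hd
  have h1 : v.val (RatFunc.C d * (RatFunc.X - RatFunc.C c)) = 1 := by
    rw [← v.val_one]
    exact le_antisymm ((hle _ _).2 hwt.le) ((hle _ _).2 hwt.ge)
  have hmem : RatFunc.C d * (RatFunc.X - RatFunc.C c) ∈ v.ring :=
    v.ring.mem_of_valuation_le_one _ h1.le
  refine ⟨h1, hmem, ?_⟩
  rw [transcendental_iff]
  intro p hp
  obtain ⟨Q, rfl⟩ := Polynomial.map_surjective _ IsLocalRing.residue_surjective p
  rw [← residue_eval₂, IsLocalRing.residue_eq_zero_iff, ValuationSubring.valuation_lt_one_iff,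
    coe_eval₂] at hp
  have hlt : w (aeval (RatFunc.C d * (RatFunc.X - RatFunc.C c)) (Q.map O.subtype)) < 1 := by
    rw [← map_one w, ← not_le, ← hle, not_le, val_one]
    exact hp
  set f : K[X] := (Q.map O.subtype).comp (C d * (Polynomial.X - C c)) with hf
  have ef : aeval (RatFunc.C d * (RatFunc.X - RatFunc.C c)) (Q.map O.subtype) =
      algebraMap K[X] (RatFunc K) f := by
    rw [← RatFunc.aeval_X_left_eq_algebraMap, hf, aeval_comp]
    simp only [map_mul, map_sub, aeval_X, aeval_C, RatFunc.algebraMap_eq_C]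
  have etaylor : taylor c f = (Q.map O.subtype).comp (C d * Polynomial.X) := by
    rw [taylor_apply, hf, comp_assoc]
    congr 1
    simp only [mul_comp, sub_comp, C_comp, X_comp, add_sub_cancel_right]
  ext i
  rw [coeff_map, coeff_zero, IsLocalRing.residue_eq_zero_iff, ValuationSubring.valuation_lt_one_iff]
  refine lt_of_le_of_lt ?_ hlt
  rw [ef, hw, Valuation.gaussRatFunc_algebraMap, etaylor]
  have h2 := Valuation.coeff_le_gaussValue (O.valuation.map (MonoidWithZeroHom.id O.ValueGroup)
    strictMono_id.monotone) r ((Q.map O.subtype).comp (C d * Polynomial.X)) i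
  refine le_trans (le_of_eq ?_) h2
  rw [comp_C_mul_X_coeff, coeff_map, map_mul, mul_assoc, map_pow, ← mul_pow]
  change _ = O.valuation _ * (O.valuation d * r) ^ i
  rw [hd, one_pow, mul_one]
  rfl

/-- For a centre c common to all balls there is a radius r with c in the closed but not in the open
ball. It is the least radius, and the Gauss extension with x - c of value r realizes A. -/
theorem exists_appr_eq_of_isResidueExtending {A : ApproxType O} (hA : A.IsResidueExtending) :
    ∃ v : ValExt O, v.IsAlmostPure ∧ v.appr = A := by
  obtain ⟨hA0, hA1, c, hc⟩ := hA
  obtain ⟨r, hr, hcr, hcr'⟩ := hA1 c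
  have hr0 : r ≠ 0 := by
    rintro rfl
    exact hA0 hr
  obtain ⟨d, hd⟩ := O.valuation_surjective r⁻¹
  have hmin : ∀ s, c ∈ A.closed s → r ≤ s := by
    intro s hs
    by_contra! hlt
    refine hcr' ?_
    rw [A.opn_of_closed s r c hs hlt]
    simpa [openValBall] using zero_lt_iff.2 hr0
  refine ⟨_, isAlmostPure_of_isResidueTranscendentalElt
    (isResidueTranscendentalElt_gaussExt hr0 c (d := d) ?_), appr_gaussExt _ _ ?_ ?_ hc⟩
  · rw [hd, inv_mul_cancel₀ hr0]
  · intro s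
    refine ⟨fun h => ?_, hmin s⟩
    rw [A.closed_of_closed r s c hcr h]
    simp [closedValBall]
  · intro s
    constructor
    · intro h
      have h' : r < s := h
      rw [A.opn_of_closed r s c hcr h']
      simpa [openValBall] using lt_of_le_of_lt zero_le h'
    · intro h
      have hs := hmin s (hc.1 s (ApproxType.mem_supp_of_mem_opn h))
      exact lt_of_le_of_ne hs (by rintro rfl; exact hcr' h)

/-- Closed and open balls of A have the same radii, so x - c must get a value lying exactly below
the support; nontriviality of A keeps 0 out of this final segment. -/
theorem exists_appr_eq_of_isValueExtending (hO : O.IsDivisible) {A : ApproxType O}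
    (hA : A.IsValueExtending) : ∃ v : ValExt O, v.IsAlmostPure ∧ v.appr = A := by
  obtain ⟨c, hc⟩ := hA.2.2
  obtain ⟨Γ, _, e, φ, he, hφ, h1, h2⟩ := exists_cut_realization hO A.supp hA.1
    fun r hr s hrs => ApproxType.supp_of_le hr hrs
  have hlt : ∀ r, φ < e r ↔ r ∈ A.supp := fun r =>
    ⟨fun h => by_contra fun hr => lt_asymm h (h2 r hr), h1 r⟩
  have hle : ∀ r, φ ≤ e r ↔ r ∈ A.supp := fun r =>
    ⟨fun h => by_contra fun hr => not_lt.2 h (h2 r hr), fun h => (h1 r h).le⟩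
  have happr : (gaussExt he hφ c).appr = A := by
    refine appr_gaussExt he hφ (fun r => ?_) (fun r => ?_) hc
    · rw [hle]
      exact ⟨fun h => hc.1 r h, fun h => ⟨c, h⟩⟩
    · rw [hlt]
      exact ⟨fun h => hc.2 r (hA.2.1 r h), ApproxType.mem_supp_of_mem_opn⟩
  refine ⟨gaussExt he hφ c, isAlmostPure_of_isValueTranscendentalElt (b := c) ?_, happr⟩
  exact isValueTranscendentalElt_of_isDivisible hO (X_sub_C_ne_zero c)
    (val_X_sub_C_notMem_range (happr ▸ hA) (happr ▸ hc))

theorem exists_appr_eq (hO : O.IsDivisible) {A : ApproxType O} (hA : A.IsAlmostPure) :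
    ∃ v : ValExt O, v.IsAlmostPure ∧ v.appr = A := by
  rcases hA with (h | h | h) | h
  · have e := ApproxType.appr_limitExt h.1 h.fixesOrVanishes
    exact ⟨_, Or.inl (Or.inr (by rwa [e])), e⟩
  · exact exists_appr_eq_of_isValueExtending hO h
  · exact exists_appr_eq_of_isResidueExtending h
  · have e := ApproxType.appr_limitExt h.1.1 h.1.fixesOrVanishes
    exact ⟨_, Or.inr (by rwa [e]), e⟩

theorem IsAlmostPure.eq_of_appr_eq (hO : O.IsDivisible) {w : ValExt O} (hv : v.IsAlmostPure)
    (hw : w.IsAlmostPure) (h : w.appr = v.appr) : w = v := by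
  rcases hv.cases with ⟨b, hb⟩ | ⟨b, d, hb⟩ | hA | hA
  · exact eq_of_isValueExtending hO hb.isValueExtending_appr h
  · exact hb.eq_of_appr_eq hw h
  · exact (approximatesOrVanishes_of_isTranscendentalImmediate hA).eq_of_appr_eq
      (approximatesOrVanishes_of_isTranscendentalImmediate (h ▸ hA)) hA.1 hA.fixesOrVanishes h
  · exact ApproximatesOrVanishes.eq_of_appr_eq (eventually_or_forall_lt hA.1)
      (eventually_or_forall_lt (h ▸ hA.1)) hA.1.1 hA.1.fixesOrVanishes h

/-! ### Classification of almost pure extensions -/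

theorem IsAlmostPure.isValueTranscendental_iff (h : v.IsAlmostPure) : v.IsValueTranscendental ↔
    (∃ b, v.IsValueTranscendentalElt (RatFunc.X - RatFunc.C b)) ∨
      v.appr.IsAlgebraicCompletionType := by
  constructor
  · intro hv
    rcases h.cases with h | ⟨b, d, h⟩ | h | h
    · exact Or.inl h
    · exact absurd h.isResidueTranscendental hv.not_isResidueTranscendental
    · exact absurd hv (isImmediate_of_appr h).not_isValueTranscendental
    · exact Or.inr h
  · rintro (⟨b, h⟩ | h)
    · exact h.isValueTranscendental
    · exact isValueTranscendental_of_appr h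

/-- Each way of being pure yields an approximation type that is value-extending, residue-extending
or transcendental immediate, and none of these is algebraic immediate. -/
theorem IsPure.not_isAlgebraicCompletionType (h : v.IsPure) :
    ¬ v.appr.IsAlgebraicCompletionType := by
  intro hA
  rcases h with ⟨b, d, h | h⟩ | h
  · exact hA.1.1.not_isValueExtending h.of_C_mul.isValueExtending_appr
  · exact hA.1.1.not_isResidueExtending h.isResidueExtending_appr
  · exact h.not_isAlgebraicImmediate hA.2

theorem IsAlmostPure.isResidueTranscendental_iff (h : v.IsAlmostPure) :
    v.IsResidueTranscendental ↔
      ∃ b d, v.IsResidueTranscendentalElt (RatFunc.C d * (RatFunc.X - RatFunc.C b)) := by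
  refine ⟨fun hv => ?_, fun ⟨b, d, h⟩ => h.isResidueTranscendental⟩
  rcases h.cases with ⟨b, h⟩ | h | h | h
  · exact absurd hv h.isValueTranscendental.not_isResidueTranscendental
  · exact h
  · exact absurd hv (isImmediate_of_appr h).not_isResidueTranscendental
  · exact absurd hv (isValueTranscendental_of_appr h).not_isResidueTranscendental

theorem IsAlmostPure.isImmediate_iff (h : v.IsAlmostPure) :
    v.IsImmediate ↔ v.appr.IsTranscendentalImmediate := by
  refine ⟨fun hv => ?_, isImmediate_of_appr⟩
  rcases h.cases with ⟨b, h⟩ | ⟨b, d, h⟩ | h | h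
  · exact absurd h.isValueTranscendental hv.not_isValueTranscendental
  · exact absurd h.isResidueTranscendental hv.not_isResidueTranscendental
  · exact h
  · exact absurd (isValueTranscendental_of_appr h) hv.not_isValueTranscendental

theorem IsAlmostPure.trichotomy (h : v.IsAlmostPure) :
    v.IsImmediate ∨ v.IsValueTranscendental ∨ v.IsResidueTranscendental := by
  rcases h.cases with ⟨b, h⟩ | ⟨b, d, h⟩ | h | h
  · exact Or.inr (Or.inl h.isValueTranscendental)
  · exact Or.inr (Or.inr h.isResidueTranscendental)
  · exact Or.inl (isImmediate_of_appr h)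
  · exact Or.inr (Or.inl (isValueTranscendental_of_appr h))

theorem IsAlmostPure.isValueTranscendental_of_isAlgebraicImmediate (h : v.IsAlmostPure)
    (hA : v.appr.IsAlgebraicImmediate) : v.IsValueTranscendental := by
  rcases h.cases with ⟨b, h⟩ | ⟨b, d, h⟩ | h | h
  · exact h.isValueTranscendental
  · exact absurd h.isResidueExtending_appr hA.1.not_isResidueExtending
  · exact absurd hA h.not_isAlgebraicImmediate
  · exact isValueTranscendental_of_appr h

end ValExt

end

theorem theorem5p7 {K : Type*} [Field K] (O : ValuationSubring K) :
    (∀ v : ValExt O, v.IsAlmostPure →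
      -- exactly one of the three cases occurs
      ((v.IsImmediate ∨ v.IsValueTranscendental ∨ v.IsResidueTranscendental) ∧
        ¬ (v.IsImmediate ∧ v.IsValueTranscendental) ∧
        ¬ (v.IsImmediate ∧ v.IsResidueTranscendental) ∧
        ¬ (v.IsValueTranscendental ∧ v.IsResidueTranscendental)) ∧
      -- immediate extensions, and algebraic immediate approximation types
      (v.IsImmediate ↔ v.appr.IsTranscendentalImmediate) ∧
      (v.appr.IsAlgebraicImmediate → v.IsValueTranscendental) ∧
      -- the value-transcendental case
      ((v.IsValueTranscendental ↔
          (∃ b : K, v.IsValueTranscendentalElt (RatFunc.X - RatFunc.C b)) ∨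
            v.appr.IsAlgebraicCompletionType) ∧
        (v.IsPure → (v.IsValueTranscendental ↔
          ∃ b : K, v.IsValueTranscendentalElt (RatFunc.X - RatFunc.C b))) ∧
        ((∃ b : K, v.IsValueTranscendentalElt (RatFunc.X - RatFunc.C b)) ↔
          v.appr.IsValueExtending) ∧
        (O.IsDivisible → v.IsValueTranscendental →
          ∀ w : ValExt O, w.IsAlmostPure → w.appr = v.appr → w = v)) ∧
      -- the residue-transcendental case
      ((v.IsResidueTranscendental ↔
          ∃ b d : K, v.IsResidueTranscendentalElt
            (RatFunc.C d * (RatFunc.X - RatFunc.C b))) ∧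
        ((∃ b d : K, v.IsResidueTranscendentalElt
            (RatFunc.C d * (RatFunc.X - RatFunc.C b))) ↔
          v.appr.IsResidueExtending) ∧
        (v.IsResidueTranscendental →
          ∀ w : ValExt O, w.IsAlmostPure → w.appr = v.appr → w = v))) ∧
    (O.IsDivisible →
      Set.BijOn (fun v : ValExt O => v.appr)
        {v | v.IsAlmostPure} {A : ApproxType O | A.IsAlmostPure}) := by
  refine ⟨fun v hv => ⟨⟨hv.trichotomy, fun h => h.1.not_isValueTranscendental h.2,
      fun h => h.1.not_isResidueTranscendental h.2, fun h => h.1.not_isResidueTranscendental h.2⟩,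
    hv.isImmediate_iff, hv.isValueTranscendental_of_isAlgebraicImmediate,
    ⟨hv.isValueTranscendental_iff, fun hp => ?_, hv.exists_isValueTranscendentalElt_iff,
      fun hO _ w hw hwv => hv.eq_of_appr_eq hO hw hwv⟩,
    hv.isResidueTranscendental_iff, hv.exists_isResidueTranscendentalElt_iff,
    fun h w hw hwv => ?_⟩, fun hO => ⟨fun v hv => ValExt.IsAlmostPure.isAlmostPure_appr hv,
      fun v hv w hw h => ValExt.IsAlmostPure.eq_of_appr_eq hO hw hv h,
      fun A hA => ValExt.exists_appr_eq hO hA⟩⟩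
  · rw [hv.isValueTranscendental_iff]
    exact or_iff_left hp.not_isAlgebraicCompletionType
  · obtain ⟨b, d, hb⟩ := hv.isResidueTranscendental_iff.1 h
    exact hb.eq_of_appr_eq hw hwv
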